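/- Let $B_2^p$ and $S^{p-1}$ be the Euclidean unit ball and unit sphere of $\mathbb{R}^p$, let $g\sim N(0,I_p)$, and for $A\subset\mathbb{R}^p$ let $w(A):=\mathbb{E}\big[\sup_{v\in A}\langle g,v\rangle\big]\in[0,\infty]$ be the Gaussian mean width of $A$, with $w(\emptyset):=0$. For $t>0$ set $w_t(A):=w\big(\tfrac1t A\cap S^{p-1}\big)$, and set $w_0(A):=w\big(\operatorname{cone}(A)\cap S^{p-1}\big)$, where $\operatorname{cone}(A):=\{s v : v\in A,\ s\ge 0\}$. Further let $K-R:=\{v-x : v\in K,\ x\in R\}$ and $K-x:=K-\{x\}$. **Proposition.** There is a universal constant $C>0$ such that for all $p\in\mathbb{N}$, all sets $K,R\subset\mathbb{R}^p$ and all $t>0$, $$w_t(K-R)\ \le\ C\cdot\Big(\sup_{x\in R} w\big(\tfrac{1}{2t}(K-x)\cap B_2^p\big)+t^{-1}\, w(R)\Big),$$ where a supremum over the empty set of such nonnegative quantities is $0$. Moreover, if $K$ is convex, then for every $x\in R$ and every $\tilde x\in K$ with $\|x-\tilde x\|_2\le t$, $$w\big(\tfrac{1}{2t}(K-x)\cap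 B_2^p\big)\ \le\ C\cdot\big(w_0(K-\tilde x)+1\big).$$ -/

import Mathlib

open MeasureTheory ProbabilityTheory
open scoped ENNReal NNReal Pointwise

/-- Expectation `E[X] = E[X⁺] - E[X⁻]` of an extended-real random variable
(the standard value in `[-∞, ∞]` whenever `E[X⁺]` and `E[X⁻]` are not both infinite). -/
noncomputable def extExpectation {Ω : Type*} [MeasurableSpace Ω] (μ : Measure Ω)
    (X : Ω → EReal) : EReal :=
  ((∫⁻ ω, (X ω).toENNReal ∂μ : ℝ≥0∞) : EReal) - ((∫⁻ ω, (-X ω).toENNReal ∂μ : ℝ≥0∞) : EReal)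

/-- The supremum `sup_{v ∈ A} ⟨g, v⟩`, with values in `[-∞, ∞]`. -/
noncomputable def supInner {p : ℕ} (A : Set (EuclideanSpace ℝ (Fin p)))
    (g : EuclideanSpace ℝ (Fin p)) : EReal :=
  ⨆ v ∈ A, ((inner ℝ g v : ℝ) : EReal)

/-- The Gaussian mean width `w(A) = E[sup_{v ∈ A} ⟨g, v⟩]`, `g ∼ N(0, I_p)`, with values in
`[0, ∞]`. For nonempty `A` the expectation is well defined and nonnegative, so that the passage
to `[0, ∞]` loses nothing (`coe_meanWidth`); for the empty set it gives the usual convention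
`w(∅) = 0` (`meanWidth_empty`). -/
noncomputable def meanWidth {p : ℕ} (A : Set (EuclideanSpace ℝ (Fin p))) : ℝ≥0∞ :=
  (extExpectation (stdGaussian (EuclideanSpace ℝ (Fin p))) (supInner A)).toENNReal

/-- The linear cone `{s v | v ∈ A, s ≥ 0}` generated by `A` (not necessarily convex). -/
def linearCone {p : ℕ} (A : Set (EuclideanSpace ℝ (Fin p))) : Set (EuclideanSpace ℝ (Fin p)) :=
  {u | ∃ v ∈ A, ∃ s : ℝ, 0 ≤ s ∧ u = s • v}

/-- The local mean width `w_t(A)` at scale `t ≥ 0`: it is `w(t⁻¹ A ∩ S^{p-1})` for `t > 0`, and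
the conic mean width `w(cone(A) ∩ S^{p-1})` for `t = 0` (negative `t` are never used). -/
noncomputable def localMeanWidth {p : ℕ} (t : ℝ) (A : Set (EuclideanSpace ℝ (Fin p))) : ℝ≥0∞ :=
  if 0 < t then meanWidth ((t⁻¹ • A) ∩ Metric.sphere 0 1)
  else meanWidth (linearCone A ∩ Metric.sphere 0 1)

/-- The variant `w((2t)⁻¹ A ∩ B₂)` of the local mean width, for `t > 0`. -/
noncomputable def localMeanWidthBall {p : ℕ} (t : ℝ)
    (A : Set (EuclideanSpace ℝ (Fin p))) : ℝ≥0∞ :=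
  meanWidth (((2 * t)⁻¹ • A) ∩ Metric.closedBall 0 1)

/-- For nonempty `A` the negative part of `sup_{v ∈ A} ⟨g, v⟩` is integrable. -/
theorem lintegral_neg_supInner_lt_top {p : ℕ} {A : Set (EuclideanSpace ℝ (Fin p))}
    (hA : A.Nonempty) :
    ∫⁻ g, (-supInner A g).toENNReal ∂(stdGaussian (EuclideanSpace ℝ (Fin p))) < ∞ := by
  obtain ⟨v, hv⟩ := hA
  have hint : Integrable (fun g : EuclideanSpace ℝ (Fin p) => -(inner ℝ g v : ℝ))
      (stdGaussian (EuclideanSpace ℝ (Fin p))) :=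
    ((IsGaussian.integrable_id (μ := stdGaussian (EuclideanSpace ℝ (Fin p)))).inner_const v).neg
  refine lt_of_le_of_lt (lintegral_mono fun g => ?_) hint.lintegral_lt_top
  rw [← EReal.real_coe_toENNReal]
  refine EReal.toENNReal_le_toENNReal ?_
  rw [EReal.coe_neg, EReal.neg_le_neg_iff]
  exact le_iSup₂_of_le v hv le_rfl

/-- For nonempty `A`, the mean width is exactly the extended-real expectation. -/
theorem coe_meanWidth {p : ℕ} {A : Set (EuclideanSpace ℝ (Fin p))} (hA : A.Nonempty) :
    (meanWidth A : EReal) =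
      extExpectation (stdGaussian (EuclideanSpace ℝ (Fin p))) (supInner A) := by
  refine EReal.coe_toENNReal ?_
  have hfin := lintegral_neg_supInner_lt_top hA
  obtain ⟨v, hv⟩ := hA
  set μ := stdGaussian (EuclideanSpace ℝ (Fin p)) with hμ
  have hle : ∀ g, ((inner ℝ g v : ℝ) : EReal) ≤ supInner A g := fun g =>
    le_iSup₂_of_le v hv le_rfl
  have hid : Integrable (fun g : EuclideanSpace ℝ (Fin p) => (inner ℝ g v : ℝ)) μ :=
    (IsGaussian.integrable_id (μ := μ)).inner_const v
  have hzero : ∫ g, (inner ℝ g v : ℝ) ∂μ = 0 := by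
    have h := integral_strongDual_stdGaussian (E := EuclideanSpace ℝ (Fin p)) (innerSL ℝ v)
    simpa [real_inner_comm] using h
  have h1 : ∫⁻ g, (-supInner A g).toENNReal ∂μ ≤ ∫⁻ g, ENNReal.ofReal (-(inner ℝ g v : ℝ)) ∂μ := by
    refine lintegral_mono fun g => ?_
    rw [← EReal.real_coe_toENNReal]
    refine EReal.toENNReal_le_toENNReal ?_
    rw [EReal.coe_neg, EReal.neg_le_neg_iff]
    exact hle g
  have h2 : ∫⁻ g, ENNReal.ofReal (inner ℝ g v : ℝ) ∂μ ≤ ∫⁻ g, (supInner A g).toENNReal ∂μ := by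
    refine lintegral_mono fun g => ?_
    rw [← EReal.real_coe_toENNReal]
    exact EReal.toENNReal_le_toENNReal (hle g)
  have h3 : ∫⁻ g, ENNReal.ofReal (-(inner ℝ g v : ℝ)) ∂μ
      = ∫⁻ g, ENNReal.ofReal (inner ℝ g v : ℝ) ∂μ := by
    have h := integral_eq_lintegral_pos_part_sub_lintegral_neg_part hid
    rw [hzero, eq_comm, sub_eq_zero] at h
    exact ((ENNReal.toReal_eq_toReal_iff' hid.lintegral_lt_top.ne
      hid.neg.lintegral_lt_top.ne).1 h).symm
  have h4 := h1.trans (h3.le.trans h2)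
  unfold extExpectation
  rw [EReal.sub_nonneg (Or.inr (by simpa using hfin.ne)) (Or.inr (by simp))]
  exact_mod_cast h4

/-- The convention for the empty set. -/
theorem meanWidth_empty {p : ℕ} : meanWidth (∅ : Set (EuclideanSpace ℝ (Fin p))) = 0 := by
  simp [meanWidth, extExpectation, supInner]

/-! ### Rotations of a pair of vectors: derivatives and norm bounds. -/

section Rotation

open Real

variable {E : Type*} [NormedAddCommGroup E] [NormedSpace ℝ E]

/-! First bound. If `w(R)` is finite, take a maximal `t`-separated set `N ⊆ R`. Sudakov minoration
bounds its size: `t √(log |N|) ≤ 14 w(R)`. A unit vector `f = t⁻¹(v - x)` with `v ∈ K`, `x ∈ R` has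
some `y ∈ N` with `‖x - y‖ ≤ t`, and `f = 2 · (2t)⁻¹(v - y) + t⁻¹(y - x)`. The second summand
contributes at most `2 t⁻¹ w(R)`. In the first, `‖v - y‖ ≤ 2t`, so `(2t)⁻¹(v - y)` lies in `(2t)⁻¹(K
- y) ∩ B₂`. A union of `|N|` subsets of the unit ball has width at most the largest of their widths
plus `3 √(log |N|)`, by Gaussian concentration, and Sudakov turns the excess into a multiple of `t⁻¹
w(R)`.

Second bound. If `‖v - x‖ ≤ 2t` then `‖v - x'‖ ≤ 3t`, so `(2t)⁻¹(v - x)` is a fixed vector plus `r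
e`, with `0 ≤ r ≤ 3/2` and `e` a unit vector of the cone of `K - x'`. The fixed vector has mean zero
against `g`.

Both Gaussian tools come from rotation invariance of a pair of independent Gaussian vectors:
differentiating at angle zero gives integration by parts, and integrating over a quarter turn gives
the Maurey–Pisier inequality. They are applied to the smooth soft maximum and its Gibbs weights.
Widths of arbitrary sets are reduced to finite subsets by monotone convergence
(`meanWidth_le_of_forall_finset`). -/

theorem hasDerivAt_rotation_fst (z : E × E) (θ : ℝ) :
    HasDerivAt (fun θ : ℝ => cos θ • z.1 + sin θ • z.2) (-sin θ • z.1 + cos θ • z.2) θ :=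
  ((hasDerivAt_cos θ).smul_const z.1).add ((hasDerivAt_sin θ).smul_const z.2)

theorem hasDerivAt_rotation_snd (z : E × E) (θ : ℝ) :
    HasDerivAt (fun θ : ℝ => -sin θ • z.1 + cos θ • z.2) (-(cos θ • z.1 + sin θ • z.2)) θ := by
  refine (((hasDerivAt_sin θ).neg.smul_const z.1).add
    ((hasDerivAt_cos θ).smul_const z.2)).congr_deriv ?_
  rw [neg_add, neg_smul, neg_smul]

theorem norm_rotation_fst_le (z : E × E) (θ : ℝ) :
    ‖cos θ • z.1 + sin θ • z.2‖ ≤ ‖z.1‖ + ‖z.2‖ := by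
  refine (norm_add_le _ _).trans ?_
  rw [norm_smul, norm_smul]
  gcongr
  · exact mul_le_of_le_one_left (norm_nonneg _) (abs_cos_le_one θ)
  · exact mul_le_of_le_one_left (norm_nonneg _) (abs_sin_le_one θ)

theorem norm_rotation_snd_le (z : E × E) (θ : ℝ) :
    ‖-sin θ • z.1 + cos θ • z.2‖ ≤ ‖z.1‖ + ‖z.2‖ := by
  refine (norm_add_le _ _).trans ?_
  rw [norm_smul, norm_smul, norm_neg]
  gcongr
  · exact mul_le_of_le_one_left (norm_nonneg _) (abs_sin_le_one θ)
  · exact mul_le_of_le_one_left (norm_nonneg _) (abs_cos_le_one θ)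

end Rotation

/-! ### Gaussian moments, integration by parts and the Maurey–Pisier inequality. -/

section Gaussian

open Filter Topology Real
open scoped RealInnerProductSpace Gradient

variable {E : Type*} [NormedAddCommGroup E] [InnerProductSpace ℝ E] [FiniteDimensional ℝ E]
  [MeasurableSpace E] [BorelSpace E]

theorem integrable_inner_stdGaussian (v : E) : Integrable (fun g : E => ⟪g, v⟫) (stdGaussian E) :=
  (IsGaussian.integrable_id (μ := stdGaussian E)).inner_const v

theorem integral_inner_stdGaussian (v : E) : ∫ g, ⟪g, v⟫ ∂(stdGaussian E) = 0 := by
  have h := integral_strongDual_stdGaussian (E := E) (innerSL ℝ v)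
  simpa [real_inner_comm] using h

theorem integrable_norm_stdGaussian : Integrable (fun g : E => ‖g‖) (stdGaussian E) :=
  (IsGaussian.integrable_id (μ := stdGaussian E)).norm

theorem integrable_norm_sq_stdGaussian : Integrable (fun g : E => ‖g‖ ^ 2) (stdGaussian E) :=
  (IsGaussian.memLp_two_id (μ := stdGaussian E)).integrable_norm_pow two_ne_zero

theorem integral_inner_mul_inner_stdGaussian (a b : E) :
    ∫ g, ⟪a, g⟫ * ⟪b, g⟫ ∂(stdGaussian E) = ⟪a, b⟫ := by
  have h := covarianceBilin_apply_eq_cov (IsGaussian.memLp_two_id (μ := stdGaussian E)) a b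
  rw [covarianceBilin_stdGaussian, covariance_eq_sub] at h
  · have hz : ∫ g, ⟪a, g⟫ ∂(stdGaussian E) = 0 := by
      simpa [real_inner_comm] using integral_inner_stdGaussian a
    rw [innerSL_apply_apply] at h
    simpa [hz] using h.symm
  all_goals exact IsGaussian.memLp_dual (stdGaussian E) (innerSL ℝ _) 2 (by simp)

theorem map_inner_stdGaussian (a : E) :
    (stdGaussian E).map (fun g => ⟪a, g⟫) = gaussianReal 0 (‖a‖₊ ^ 2) := by
  have h := IsGaussian.map_eq_gaussianReal (μ := stdGaussian E) (innerSL ℝ a)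
  rw [integral_strongDual_stdGaussian, variance_dual_stdGaussian] at h
  have h2 : ((‖innerSL ℝ a‖ ^ 2).toNNReal : ℝ≥0) = ‖a‖₊ ^ 2 := by
    rw [innerSL_apply_norm]
    ext
    simp
  rw [h2] at h
  exact h

theorem lintegral_exp_inner_stdGaussian (a : E) :
    ∫⁻ g, ENNReal.ofReal (exp ⟪a, g⟫) ∂(stdGaussian E) = ENNReal.ofReal (exp (‖a‖ ^ 2 / 2)) := by
  have h1 : ∫⁻ g, ENNReal.ofReal (exp ⟪a, g⟫) ∂(stdGaussian E)
      = ∫⁻ x, ENNReal.ofReal (exp x) ∂((stdGaussian E).map (fun g => ⟪a, g⟫)) := by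
    rw [lintegral_map (by fun_prop) (by fun_prop)]
  have hi := integrable_exp_mul_gaussianReal (μ := 0) (v := ‖a‖₊ ^ 2) 1
  have hm := mgf_gaussianReal (p := gaussianReal 0 (‖a‖₊ ^ 2)) (X := id) (Measure.map_id) 1
  simp only [one_mul] at hi
  rw [h1, map_inner_stdGaussian, ← ofReal_integral_eq_lintegral_ofReal hi
    (Eventually.of_forall fun _ => (exp_pos _).le)]
  simp only [mgf, one_mul, id] at hm
  rw [hm]
  simp

theorem map_rotation_stdGaussian (θ : ℝ) :
    ((stdGaussian E).prod (stdGaussian E)).map (ContinuousLinearMap.rotation θ)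
      = (stdGaussian E).prod (stdGaussian E) :=
  IsGaussian.map_rotation_eq_self (by simp) θ

/-- **Gaussian integration by parts** for bounded functions with bounded continuous gradient. -/
theorem integral_mul_inner_stdGaussian {f : E → ℝ} {f' : E → E}
    (hf : ∀ x, HasGradientAt f (f' x) x) (hf' : Continuous f') {M : ℝ}
    (hM : ∀ x, |f x| ≤ M) (hM' : ∀ x, ‖f' x‖ ≤ M) (x : E) :
    ∫ g, f g * ⟪x, g⟫ ∂(stdGaussian E) = ∫ g, ⟪f' g, x⟫ ∂(stdGaussian E) := by
  set γ := stdGaussian E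
  have hfc : Continuous f := continuous_iff_continuousAt.2 fun y => (hf y).continuousAt
  have hM0 : 0 ≤ M := (abs_nonneg _).trans (hM 0)
  -- By rotation invariance the mean of `G θ` equals that of `f z.1 * ⟪x, z.2⟫`, which is zero for
  -- every `θ`. The vanishing of its derivative at `θ = 0` is the claimed identity, once `z.2` is
  -- integrated out.
  set G : ℝ → E × E → ℝ := fun θ z =>
    f (cos θ • z.1 + sin θ • z.2) * ⟪x, -sin θ • z.1 + cos θ • z.2⟫ with hG
  set G' : ℝ → E × E → ℝ := fun θ z =>
    ⟪f' (cos θ • z.1 + sin θ • z.2), -sin θ • z.1 + cos θ • z.2⟫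
        * ⟪x, -sin θ • z.1 + cos θ • z.2⟫
      + f (cos θ • z.1 + sin θ • z.2) * ⟪x, -(cos θ • z.1 + sin θ • z.2)⟫ with hG'
  have hx : Integrable (fun g : E => ⟪x, g⟫) γ := by
    simpa [real_inner_comm] using integrable_inner_stdGaussian x
  have hx0 : ∫ g, ⟪x, g⟫ ∂γ = 0 := by
    simpa [real_inner_comm] using integral_inner_stdGaussian x
  have hfb : Integrable f γ :=
    Integrable.of_bound hfc.aestronglyMeasurable M (Eventually.of_forall hM)
  have hGconst : ∀ θ, ∫ z, G θ z ∂(γ.prod γ) = 0 := by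
    intro θ
    have h0 : ∫ z : E × E, f z.1 * ⟪x, z.2⟫ ∂(γ.prod γ) = 0 := by
      rw [integral_prod_mul f (fun g => ⟪x, g⟫), hx0, mul_zero]
    rw [← map_rotation_stdGaussian θ, integral_map (by fun_prop) (by
      exact (by fun_prop : Continuous fun z : E × E =>
        f z.1 * ⟪x, z.2⟫).aestronglyMeasurable)] at h0
    exact h0
  have hN1 : Integrable (fun z : E × E => ‖z.1‖) (γ.prod γ) :=
    (integrable_norm_stdGaussian (E := E)).comp_fst γ
  have hN2 : Integrable (fun z : E × E => ‖z.2‖) (γ.prod γ) :=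
    (integrable_norm_stdGaussian (E := E)).comp_snd γ
  have hN3 : Integrable (fun z : E × E => ‖z.1‖ ^ 2) (γ.prod γ) :=
    (integrable_norm_sq_stdGaussian (E := E)).comp_fst γ
  have hN4 : Integrable (fun z : E × E => ‖z.2‖ ^ 2) (γ.prod γ) :=
    (integrable_norm_sq_stdGaussian (E := E)).comp_snd γ
  set b : E × E → ℝ := fun z =>
    2 * M * ‖x‖ * (‖z.1‖ ^ 2 + ‖z.2‖ ^ 2) + M * ‖x‖ * (‖z.1‖ + ‖z.2‖) with hb
  have hbi : Integrable b (γ.prod γ) := ((hN3.add hN4).const_mul _).add ((hN1.add hN2).const_mul _)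
  have hbound : ∀ θ z, ‖G' θ z‖ ≤ b z := by
    intro θ z
    have h1 := norm_rotation_fst_le z θ
    have h2 := norm_rotation_snd_le z θ
    have h3 := abs_real_inner_le_norm (f' (cos θ • z.1 + sin θ • z.2)) (-sin θ • z.1 + cos θ • z.2)
    have h4 := abs_real_inner_le_norm x (-sin θ • z.1 + cos θ • z.2)
    have h5 := abs_real_inner_le_norm x (-(cos θ • z.1 + sin θ • z.2))
    rw [norm_neg] at h5
    have h6 := hM' (cos θ • z.1 + sin θ • z.2)
    have h7 := hM (cos θ • z.1 + sin θ • z.2)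
    have e1 : ‖G' θ z‖ ≤ (M * (‖z.1‖ + ‖z.2‖)) * (‖x‖ * (‖z.1‖ + ‖z.2‖))
        + M * (‖x‖ * (‖z.1‖ + ‖z.2‖)) := by
      simp only [hG', Real.norm_eq_abs]
      refine (abs_add_le _ _).trans ?_
      rw [abs_mul, abs_mul]
      gcongr
      · exact h3.trans (by gcongr)
      · exact h4.trans (by gcongr)
      · exact h5.trans (by gcongr)
    refine e1.trans ?_
    have : 0 ≤ M * ‖x‖ * (‖z.1‖ - ‖z.2‖) ^ 2 := by positivity
    simp only [hb]
    nlinarith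
  have hderiv : ∀ θ z, HasDerivAt (fun θ => G θ z) (G' θ z) θ := by
    intro θ z
    have h1 := (hf (cos θ • z.1 + sin θ • z.2)).hasFDerivAt.comp_hasDerivAt θ
      (hasDerivAt_rotation_fst z θ)
    have h2 := (innerSL ℝ x).hasFDerivAt.comp_hasDerivAt θ (hasDerivAt_rotation_snd z θ)
    exact h1.mul h2
  have hGcont : ∀ θ, Continuous (G θ) := fun θ => by simp only [hG]; fun_prop
  have hG'cont : ∀ θ, Continuous (G' θ) := fun θ => by simp only [hG']; fun_prop
  have key := hasDerivAt_integral_of_dominated_loc_of_deriv_le (μ := γ.prod γ) (F := G) (F' := G')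
    (x₀ := (0 : ℝ)) (s := Set.univ) (bound := b) univ_mem
    (Eventually.of_forall fun θ => (hGcont θ).aestronglyMeasurable)
    (by
      have : Integrable (fun z : E × E => f z.1 * ⟪x, z.2⟫) (γ.prod γ) := hfb.mul_prod hx
      simpa [hG] using this)
    (hG'cont 0).aestronglyMeasurable
    (Eventually.of_forall fun z θ _ => hbound θ z) hbi
    (Eventually.of_forall fun z θ _ => hderiv θ z)
  have hzero : ∫ z, G' 0 z ∂(γ.prod γ) = 0 := by
    have h2 := key.2
    simp only [hGconst] at h2
    exact h2.unique (hasDerivAt_const _ _)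
  have hG'0 : ∀ z : E × E, G' 0 z = ⟪f' z.1, z.2⟫ * ⟪x, z.2⟫ - f z.1 * ⟪x, z.1⟫ := by
    intro z; simp [hG', sub_eq_add_neg]
  have hi2 : Integrable (fun z : E × E => f z.1 * ⟪x, z.1⟫) (γ.prod γ) := by
    have : Integrable (fun g : E => f g * ⟪x, g⟫) γ :=
      hx.bdd_mul hfc.aestronglyMeasurable (Eventually.of_forall hM)
    exact this.comp_fst γ
  have hi1 : Integrable (fun z : E × E => ⟪f' z.1, z.2⟫ * ⟪x, z.2⟫) (γ.prod γ) := by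
    have := key.1.add hi2
    refine this.congr (Eventually.of_forall fun z => ?_)
    simp [hG'0]
  simp only [hG'0] at hzero
  rw [integral_sub hi1 hi2, integral_prod _ hi1, integral_prod _ hi2, sub_eq_zero] at hzero
  simp only [γ, integral_inner_mul_inner_stdGaussian] at hzero
  simpa using hzero.symm

/-- **Maurey–Pisier**: sub-Gaussian increments between two independent standard Gaussian vectors of
a function whose gradient has norm at most one. -/
theorem lintegral_exp_mul_sub_stdGaussian_le {F : E → ℝ} {F' : E → E}
    (hF : ∀ x, HasGradientAt F (F' x) x) (hF' : Continuous F') (hb : ∀ x, ‖F' x‖ ≤ 1) (c : ℝ) :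
    ∫⁻ z, ENNReal.ofReal (exp (c * (F z.2 - F z.1))) ∂((stdGaussian E).prod (stdGaussian E))
      ≤ ENNReal.ofReal (exp (c ^ 2 * π ^ 2 / 8)) := by
  set γ := stdGaussian E
  have hFc : Continuous F := continuous_iff_continuousAt.2 fun y => (hF y).continuousAt
  set k : ℝ → E × E → ℝ := fun θ z =>
    ⟪F' (cos θ • z.1 + sin θ • z.2), -sin θ • z.1 + cos θ • z.2⟫ with hk
  have hkc : Continuous fun q : ℝ × (E × E) => k q.1 q.2 := by simp only [hk]; fun_prop
  have hkz : ∀ z, Continuous fun θ => k θ z := fun z => by fun_prop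
  have hftc : ∀ z, ∫ θ in (0 : ℝ)..(π / 2), k θ z = F z.2 - F z.1 := by
    intro z
    have hd : ∀ θ ∈ Set.uIcc 0 (π / 2),
        HasDerivAt (fun θ => F (cos θ • z.1 + sin θ • z.2)) (k θ z) θ := by
      intro θ _
      have h1 := (hF (cos θ • z.1 + sin θ • z.2)).hasFDerivAt.comp_hasDerivAt θ
        (hasDerivAt_rotation_fst z θ)
      simpa [hk, Function.comp_def] using h1
    rw [intervalIntegral.integral_eq_sub_of_hasDerivAt hd ((hkz z).intervalIntegrable _ _)]
    simp
  have hpi : (0 : ℝ) < π / 2 := by positivity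
  -- Jensen over the quarter turn, via the tangent line of `exp` at `a`, the average over `θ` of `c
  -- * (π / 2) * k θ z`.
  have hjensen : ∀ z, exp (c * (F z.2 - F z.1)) * (π / 2)
      ≤ ∫ θ in (0 : ℝ)..(π / 2), exp (c * (π / 2) * k θ z) := by
    intro z
    set a := c * (F z.2 - F z.1) with ha
    have h1 : ∫ θ in (0 : ℝ)..(π / 2), exp a * (1 - a + c * (π / 2) * k θ z)
        = exp a * (π / 2) := by
      rw [intervalIntegral.integral_const_mul, intervalIntegral.integral_add
        (by simp) ((by fun_prop : Continuous _).intervalIntegrable _ _),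
        intervalIntegral.integral_const_mul, hftc]
      simp only [intervalIntegral.integral_const, smul_eq_mul, ha]
      ring
    rw [← h1]
    refine intervalIntegral.integral_mono_on hpi.le
      ((by fun_prop : Continuous _).intervalIntegrable _ _)
      ((by fun_prop : Continuous _).intervalIntegrable _ _) fun θ _ => ?_
    have h2 := add_one_le_exp (c * (π / 2) * k θ z - a)
    calc exp a * (1 - a + c * (π / 2) * k θ z) ≤ exp a * exp (c * (π / 2) * k θ z - a) := by
          gcongr; linarith
      _ = _ := by rw [← exp_add]; congr 1; ring
  have hpt : ∀ z, ENNReal.ofReal (exp (c * (F z.2 - F z.1))) * ENNReal.ofReal (π / 2)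
      ≤ ∫⁻ θ in Set.Ioc 0 (π / 2), ENNReal.ofReal (exp (c * (π / 2) * k θ z)) := by
    intro z
    rw [← ENNReal.ofReal_mul (exp_pos _).le]
    refine (ENNReal.ofReal_le_ofReal (hjensen z)).trans ?_
    rw [intervalIntegral.integral_of_le hpi.le, ofReal_integral_eq_lintegral_ofReal]
    · exact ((by fun_prop : Continuous fun θ => exp (c * (π / 2) * k θ z)).intervalIntegrable
        0 (π / 2)).1
    · exact Eventually.of_forall fun _ => (exp_pos _).le
  -- After rotation the exponent is `c (π / 2) ⟪F' z.1, z.2⟫`. Given `z.1` it is Gaussian with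
  -- variance at most `(c π / 2) ^ 2`, and half of that is `c ^ 2 π ^ 2 / 8`.
  have hrot : ∀ θ, ∫⁻ z, ENNReal.ofReal (exp (c * (π / 2) * k θ z)) ∂(γ.prod γ)
      ≤ ENNReal.ofReal (exp (c ^ 2 * π ^ 2 / 8)) := by
    intro θ
    have hΨ : Measurable fun z : E × E => ENNReal.ofReal (exp (c * (π / 2) * ⟪F' z.1, z.2⟫)) :=
      (by fun_prop : Continuous fun z : E × E => exp (c * (π / 2) * ⟪F' z.1, z.2⟫)).measurable.ennreal_ofReal
    have h1 : ∫⁻ z, ENNReal.ofReal (exp (c * (π / 2) * k θ z)) ∂(γ.prod γ)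
        = ∫⁻ z : E × E, ENNReal.ofReal (exp (c * (π / 2) * ⟪F' z.1, z.2⟫)) ∂(γ.prod γ) := by
      conv_rhs => rw [← map_rotation_stdGaussian θ]
      rw [lintegral_map hΨ (by fun_prop)]
      rfl
    rw [h1, lintegral_prod _ hΨ.aemeasurable]
    calc _ ≤ ∫⁻ _ : E, ENNReal.ofReal (exp (c ^ 2 * π ^ 2 / 8)) ∂γ := by
          refine lintegral_mono fun y => ?_
          have h2 := lintegral_exp_inner_stdGaussian ((c * (π / 2)) • F' y)
          simp only [real_inner_smul_left] at h2
          simp only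
          rw [h2]
          refine ENNReal.ofReal_le_ofReal (exp_le_exp.2 ?_)
          rw [norm_smul, mul_pow, Real.norm_eq_abs, sq_abs]
          have h3 : ‖F' y‖ ^ 2 ≤ 1 := pow_le_one₀ (norm_nonneg _) (hb y)
          nlinarith [sq_nonneg (c * (π / 2))]
      _ = _ := by simp
  have hmeas : Measurable fun q : (E × E) × ℝ =>
      ENNReal.ofReal (exp (c * (π / 2) * k q.2 q.1)) :=
    (by fun_prop : Continuous fun q : (E × E) × ℝ =>
      exp (c * (π / 2) * k q.2 q.1)).measurable.ennreal_ofReal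
  have hfinal : (∫⁻ z, ENNReal.ofReal (exp (c * (F z.2 - F z.1))) ∂(γ.prod γ))
      * ENNReal.ofReal (π / 2) ≤ ENNReal.ofReal (exp (c ^ 2 * π ^ 2 / 8)) * ENNReal.ofReal (π / 2) := by
    rw [← lintegral_mul_const _ (by
      exact (by fun_prop : Continuous fun z : E × E =>
        exp (c * (F z.2 - F z.1))).measurable.ennreal_ofReal)]
    refine (lintegral_mono hpt).trans ?_
    rw [lintegral_lintegral_swap hmeas.aemeasurable]
    refine (lintegral_mono hrot).trans ?_
    simp
  exact (ENNReal.mul_le_mul_iff_left (by simpa using hpi) (by simp)).1 hfinal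

end Gaussian

/-! ### The soft maximum of finitely many linear functionals and its Gibbs weights. -/

section SoftMax

open Real
open scoped RealInnerProductSpace Gradient

variable {ι E : Type*} [NormedAddCommGroup E] [InnerProductSpace ℝ E]

/-- The partition function `∑ exp (β ⟪g, uᵢ⟫)`. -/
noncomputable def partitionFn (s : Finset ι) (u : ι → E) (β : ℝ) (g : E) : ℝ :=
  ∑ i ∈ s, exp (β * ⟪g, u i⟫)

/-- The Gibbs weights `exp (β ⟪g, uᵢ⟫) / ∑ exp (β ⟪g, uⱼ⟫)`. -/
noncomputable def gibbs (s : Finset ι) (u : ι → E) (β : ℝ) (g : E) (i : ι) : ℝ :=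
  exp (β * ⟪g, u i⟫) / partitionFn s u β g

/-- The smooth approximation `β⁻¹ log ∑ exp (β ⟪g, uᵢ⟫)` of the maximum of the `⟪g, uᵢ⟫`. -/
noncomputable def softMax (s : Finset ι) (u : ι → E) (β : ℝ) (g : E) : ℝ :=
  β⁻¹ * log (partitionFn s u β g)

variable {s : Finset ι}

theorem partitionFn_pos (hs : s.Nonempty) (u : ι → E) (β : ℝ) (g : E) : 0 < partitionFn s u β g :=
  Finset.sum_pos (fun _ _ => exp_pos _) hs

theorem gibbs_nonneg (hs : s.Nonempty) (u : ι → E) (β : ℝ) (g : E) (i : ι) : 0 ≤ gibbs s u β g i :=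
  div_nonneg (exp_pos _).le (partitionFn_pos hs u β g).le

theorem sum_gibbs (hs : s.Nonempty) (u : ι → E) (β : ℝ) (g : E) : ∑ i ∈ s, gibbs s u β g i = 1 := by
  simp only [gibbs]
  rw [← Finset.sum_div]
  exact div_self (partitionFn_pos hs u β g).ne'

theorem gibbs_le_one (hs : s.Nonempty) (u : ι → E) (β : ℝ) (g : E) {i : ι} (hi : i ∈ s) : gibbs s u β g i ≤ 1 := by
  rw [← sum_gibbs hs u β g]
  exact Finset.single_le_sum (fun j _ => gibbs_nonneg hs u β g j) hi

theorem continuous_gibbs (hs : s.Nonempty) (u : ι → E) (β : ℝ) (i : ι) : Continuous fun g => gibbs s u β g i := by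
  have : Continuous fun g => partitionFn s u β g := by unfold partitionFn; fun_prop
  exact Continuous.div (by fun_prop) this fun g => (partitionFn_pos hs u β g).ne'

theorem hasFDerivAt_exp_inner (β : ℝ) (g : E) (v : E) :
    HasFDerivAt (fun g : E => exp (β * ⟪g, v⟫)) ((β * exp (β * ⟪g, v⟫)) • innerSL ℝ v) g := by
  have h : HasFDerivAt (fun g : E => β * ⟪g, v⟫) (β • innerSL ℝ v) g := by
    have := (innerSL ℝ v).hasFDerivAt.const_mul β (x := g)
    simpa [real_inner_comm] using this
  convert h.exp using 1
  rw [smul_smul, mul_comm]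

theorem hasFDerivAt_partitionFn (u : ι → E) (β : ℝ) (g : E) :
    HasFDerivAt (fun g => partitionFn s u β g)
      (∑ i ∈ s, (β * exp (β * ⟪g, u i⟫)) • innerSL ℝ (u i)) g := by
  unfold partitionFn
  exact HasFDerivAt.fun_sum fun i _ => hasFDerivAt_exp_inner β g (u i)

theorem hasGradientAt_softMax (hs : s.Nonempty) (u : ι → E) (β : ℝ) (g : E) [CompleteSpace E] (hβ : β ≠ 0) :
    HasGradientAt (softMax s u β) (∑ i ∈ s, gibbs s u β g i • u i) g := by
  rw [hasGradientAt_iff_hasFDerivAt]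
  have h := ((hasFDerivAt_partitionFn u β g (s := s)).log
    (partitionFn_pos hs u β g).ne').const_mul β⁻¹
  refine h.congr_fderiv ?_
  ext w
  simp only [smul_apply, sum_apply, innerSL_apply_apply,
    smul_eq_mul, InnerProductSpace.toDual_apply_apply, sum_inner, real_inner_smul_left, gibbs,
    Finset.mul_sum]
  refine Finset.sum_congr rfl fun i _ => ?_
  field_simp

theorem hasGradientAt_gibbs (hs : s.Nonempty) (u : ι → E) (β : ℝ) (g : E) [CompleteSpace E] (i : ι) :
    HasGradientAt (fun g => gibbs s u β g i)
      ((β * gibbs s u β g i) • (u i - ∑ j ∈ s, gibbs s u β g j • u j)) g := by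
  rw [hasGradientAt_iff_hasFDerivAt]
  have hZ := (partitionFn_pos hs u β g).ne'
  have h := (hasFDerivAt_exp_inner β g (u i)).mul
    ((hasDerivAt_inv hZ).comp_hasFDerivAt g (hasFDerivAt_partitionFn u β g))
  refine (h.congr_fderiv ?_)
  ext w
  simp only [smul_apply, sum_apply, innerSL_apply_apply,
    add_apply,
    smul_eq_mul, InnerProductSpace.toDual_apply_apply, sum_inner, real_inner_smul_left, gibbs,
    inner_sub_left, Function.comp_apply]
  have h1 : ∑ j ∈ s, exp (β * ⟪g, u j⟫) / partitionFn s u β g * ⟪u j, w⟫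
      = (∑ j ∈ s, exp (β * ⟪g, u j⟫) * ⟪u j, w⟫) / partitionFn s u β g := by
    rw [Finset.sum_div]
    exact Finset.sum_congr rfl fun j _ => by ring
  have h2 : ∑ j ∈ s, β * exp (β * ⟪g, u j⟫) * ⟪u j, w⟫
      = β * ∑ j ∈ s, exp (β * ⟪g, u j⟫) * ⟪u j, w⟫ := by
    rw [Finset.mul_sum]
    exact Finset.sum_congr rfl fun j _ => by ring
  rw [h1, h2]
  field_simp
  ring_nf

theorem continuous_sum_gibbs_smul (hs : s.Nonempty) (u : ι → E) (β : ℝ) : Continuous fun g => ∑ i ∈ s, gibbs s u β g i • u i :=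
  continuous_finsetSum _ fun i _ => (continuous_gibbs hs u β i).smul continuous_const

/-- The gradient of the soft maximum is a convex combination of the `u i`. For vectors in the unit
ball this is the gradient bound that concentration requires, uniformly in `β`. -/
theorem norm_sum_gibbs_smul_le (hs : s.Nonempty) (u : ι → E) (β : ℝ) (g : E) {M : ℝ} (hu : ∀ i ∈ s, ‖u i‖ ≤ M) :
    ‖∑ i ∈ s, gibbs s u β g i • u i‖ ≤ M := by
  calc _ ≤ ∑ i ∈ s, gibbs s u β g i * M := by
        refine norm_sum_le_of_le _ fun i hi => ?_
        rw [norm_smul, Real.norm_eq_abs, abs_of_nonneg (gibbs_nonneg hs u β g i)]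
        exact mul_le_mul_of_nonneg_left (hu i hi) (gibbs_nonneg hs u β g i)
    _ = M := by rw [← Finset.sum_mul, sum_gibbs hs, one_mul]

theorem inner_le_softMax (u : ι → E) (g : E) {β : ℝ} (hβ : 0 < β) {i : ι} (hi : i ∈ s) :
    ⟪g, u i⟫ ≤ softMax s u β g := by
  rw [softMax, ← div_eq_inv_mul, le_div_iff₀ hβ,
    le_log_iff_exp_le (partitionFn_pos ⟨i, hi⟩ u β g), mul_comm]
  exact Finset.single_le_sum (f := fun i => exp (β * ⟪g, u i⟫)) (fun j _ => (exp_pos _).le) hi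

theorem softMax_le (hs : s.Nonempty) (u : ι → E) (g : E) {β : ℝ} (hβ : 0 < β) {b : ℝ} (hb : ∀ i ∈ s, ⟪g, u i⟫ ≤ b) :
    softMax s u β g ≤ b + log s.card / β := by
  have hc : (0 : ℝ) < s.card := by exact_mod_cast hs.card_pos
  have h : partitionFn s u β g ≤ s.card * exp (β * b) := by
    rw [← nsmul_eq_mul]
    exact Finset.sum_le_card_nsmul _ _ _ fun i hi =>
      exp_le_exp.2 (mul_le_mul_of_nonneg_left (hb i hi) hβ.le)
  have h2 := log_le_log (partitionFn_pos hs u β g) h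
  rw [log_mul hc.ne' (exp_pos _).ne', log_exp] at h2
  rw [softMax, ← div_eq_inv_mul, div_le_iff₀ hβ, add_mul, div_mul_cancel₀ _ hβ.ne']
  linarith

theorem continuous_softMax (hs : s.Nonempty) (u : ι → E) (β : ℝ) [CompleteSpace E] (hβ : β ≠ 0) : Continuous (softMax s u β) :=
  continuous_iff_continuousAt.2 fun g => (hasGradientAt_softMax hs u β g hβ).continuousAt

end SoftMax

/-! ### Expected maxima of finitely many Gaussian linear functionals. -/

section MaxInner

open Real
open scoped RealInnerProductSpace

variable {ι E : Type*} [NormedAddCommGroup E] [InnerProductSpace ℝ E]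

/-- The maximum of the `⟪g, uᵢ⟫` over a nonempty finite set of indices. -/
noncomputable def maxInner (s : Finset ι) (hs : s.Nonempty) (u : ι → E) (g : E) : ℝ :=
  s.sup' hs fun i => ⟪g, u i⟫

variable {s : Finset ι} (hs : s.Nonempty) (u : ι → E) (g : E)

theorem inner_le_maxInner {i : ι} (hi : i ∈ s) : ⟪g, u i⟫ ≤ maxInner s hs u g :=
  Finset.le_sup' (fun i => ⟪g, u i⟫) hi

theorem maxInner_le_iff {a : ℝ} : maxInner s hs u g ≤ a ↔ ∀ i ∈ s, ⟪g, u i⟫ ≤ a :=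
  Finset.sup'_le_iff hs _

theorem continuous_maxInner : Continuous (maxInner s hs u) := by
  unfold maxInner
  exact Continuous.finset_sup'_apply hs fun i _ => by fun_prop

theorem abs_maxInner_le : |maxInner s hs u g| ≤ ‖g‖ * ∑ i ∈ s, ‖u i‖ := by
  have h : ∀ i ∈ s, |⟪g, u i⟫| ≤ ‖g‖ * ∑ i ∈ s, ‖u i‖ := fun i hi =>
    (abs_real_inner_le_norm _ _).trans (by
      gcongr
      exact Finset.single_le_sum (f := fun i => ‖u i‖) (fun _ _ => norm_nonneg _) hi)
  rw [abs_le]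
  obtain ⟨i, hi⟩ := hs
  exact ⟨(abs_le.1 (h i hi)).1.trans (inner_le_maxInner _ u g hi),
    (maxInner_le_iff _ u g).2 fun j hj => (abs_le.1 (h j hj)).2⟩

variable [FiniteDimensional ℝ E] [MeasurableSpace E] [BorelSpace E]

theorem integrable_maxInner : Integrable (maxInner s hs u) (stdGaussian E) := by
  refine ((integrable_norm_stdGaussian (E := E)).mul_const (∑ i ∈ s, ‖u i‖)).mono'
    (continuous_maxInner hs u).aestronglyMeasurable (Filter.Eventually.of_forall fun g => ?_)
  exact abs_maxInner_le hs u g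

theorem integral_maxInner_nonneg : 0 ≤ ∫ g, maxInner s hs u g ∂(stdGaussian E) := by
  obtain ⟨i, hi⟩ := id hs
  rw [← integral_inner_stdGaussian (u i)]
  exact integral_mono (integrable_inner_stdGaussian _) (integrable_maxInner hs u)
    fun g => inner_le_maxInner hs u g hi

/-- The Gaussian law is invariant under `g ↦ -g`. This lets `-R` be charged to the width of `R`. -/
theorem integral_maxInner_neg :
    ∫ g, maxInner s hs (fun i => -u i) g ∂(stdGaussian E)
      = ∫ g, maxInner s hs u g ∂(stdGaussian E) := by
  conv_rhs => rw [← stdGaussian_map (E := E) (LinearIsometryEquiv.neg ℝ)]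
  rw [integral_map (by fun_prop) (continuous_maxInner hs u).aestronglyMeasurable]
  simp [maxInner]

theorem integrable_softMax (hs : s.Nonempty) {β : ℝ} (hβ : 0 < β) : Integrable (softMax s u β) (stdGaussian E) := by
  refine ((integrable_maxInner hs u).norm.add
    (integrable_const (log s.card / β))).mono'
    (continuous_softMax hs u β hβ.ne').aestronglyMeasurable
    (Filter.Eventually.of_forall fun g => ?_)
  have h1 := softMax_le hs u g hβ (b := maxInner s hs u g)
    fun i hi => inner_le_maxInner hs u g hi
  have h2 : maxInner s hs u g ≤ softMax s u β g :=
    (maxInner_le_iff hs u g).2 fun i hi => inner_le_softMax u g hβ hi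
  have h3 : 0 ≤ log s.card / β := div_nonneg (log_natCast_nonneg _) hβ.le
  simp only [Pi.add_apply, Real.norm_eq_abs]
  rw [abs_le]
  constructor
  · linarith [neg_abs_le (maxInner s hs u g)]
  · linarith [le_abs_self (maxInner s hs u g)]

theorem integral_softMax_le (hs : s.Nonempty) {β : ℝ} (hβ : 0 < β) :
    ∫ g, softMax s u β g ∂(stdGaussian E)
      ≤ ∫ g, maxInner s hs u g ∂(stdGaussian E) + log s.card / β := by
  have : ∫ g, (maxInner s hs u g + log s.card / β) ∂(stdGaussian E)
      = ∫ g, maxInner s hs u g ∂(stdGaussian E) + log s.card / β := by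
    rw [integral_add (integrable_maxInner hs u) (integrable_const _)]; simp
  rw [← this]
  exact integral_mono (integrable_softMax u hs hβ)
    ((integrable_maxInner hs u).add (integrable_const _))
    fun g => softMax_le hs u g hβ fun i hi => inner_le_maxInner hs u g hi

end MaxInner

/-! ### Maxima over finite unions: the cost of a union bound. -/

section Concentration

open Real
open scoped RealInnerProductSpace Gradient

variable {J E : Type*} [NormedAddCommGroup E] [InnerProductSpace ℝ E]
  [FiniteDimensional ℝ E] [MeasurableSpace E] [BorelSpace E]

/-- The expected maximum of functions with gradients of norm at most one exceeds the maximum of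
their expectations by at most `log N / c + c π² / 8`, for all `c > 0`. -/
theorem exists_integral_le_and_forall_le {t : Finset J} (ht : t.Nonempty) {F : J → E → ℝ}
    {F' : J → E → E} (hF : ∀ j ∈ t, ∀ x, HasGradientAt (F j) (F' j x) x)
    (hF' : ∀ j ∈ t, Continuous (F' j)) (hb : ∀ j ∈ t, ∀ x, ‖F' j x‖ ≤ 1)
    (hint : ∀ j ∈ t, Integrable (F j) (stdGaussian E)) {m : ℝ}
    (hm : ∀ j ∈ t, ∫ x, F j x ∂(stdGaussian E) ≤ m) {c : ℝ} (hc : 0 < c) :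
    ∃ H : E → ℝ, Integrable H (stdGaussian E) ∧ (∀ j ∈ t, ∀ᵐ x ∂(stdGaussian E), F j x ≤ H x) ∧
      ∫ x, H x ∂(stdGaussian E) ≤ m + log t.card / c + c * π ^ 2 / 8 := by
  set γ := stdGaussian E
  have hN : (0 : ℝ) < t.card := by exact_mod_cast ht.card_pos
  set D : J → E × E → ℝ := fun j z => exp (c * (F j z.2 - F j z.1)) with hD
  have hDc : ∀ j ∈ t, Continuous (D j) := fun j hj => by
    have : Continuous (F j) := continuous_iff_continuousAt.2 fun y => (hF j hj y).continuousAt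
    simp only [hD]; fun_prop
  set b := exp (c ^ 2 * π ^ 2 / 8) with hbdef
  have hMP : ∀ j ∈ t, ∫⁻ z, ENNReal.ofReal (D j z) ∂(γ.prod γ) ≤ ENNReal.ofReal b := fun j hj =>
    lintegral_exp_mul_sub_stdGaussian_le (hF j hj) (hF' j hj) (hb j hj) c
  have hDpos : ∀ j z, 0 ≤ D j z := fun j z => (exp_pos _).le
  have hDi : ∀ j ∈ t, Integrable (D j) (γ.prod γ) := fun j hj =>
    ⟨(hDc j hj).aestronglyMeasurable, by
      rw [hasFiniteIntegral_iff_ofReal (Filter.Eventually.of_forall (hDpos j))]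
      exact (hMP j hj).trans_lt ENNReal.ofReal_lt_top⟩
  have hDint : ∀ j ∈ t, ∫ z, D j z ∂(γ.prod γ) ≤ b := fun j hj => by
    rw [integral_eq_lintegral_of_nonneg_ae (Filter.Eventually.of_forall (hDpos j))
      (hDc j hj).aestronglyMeasurable]
    exact ENNReal.toReal_le_of_le_ofReal (exp_pos _).le (hMP j hj)
  set a := t.card * b with ha
  have hb0 : 0 < b := exp_pos _
  have ha0 : 0 < a := mul_pos hN hb0
  -- Each increment is at most `c⁻¹ log (∑ D j)`; the logarithm is replaced by its tangent line at
  -- `a`, an upper bound for the mean of the sum. `Q` is then affine in the `D j`, and its mean is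
  -- at most `c⁻¹ log a`.
  set Q : E × E → ℝ := fun z => c⁻¹ * (log a - 1 + a⁻¹ * ∑ j ∈ t, D j z) with hQ
  have hsum : Integrable (fun z => ∑ j ∈ t, D j z) (γ.prod γ) := integrable_finsetSum _ hDi
  have hQi : Integrable Q (γ.prod γ) :=
    ((integrable_const _).add (hsum.const_mul _)).const_mul _
  have hQint : ∫ z, Q z ∂(γ.prod γ) ≤ log t.card / c + c * π ^ 2 / 8 := by
    have h1 : ∫ z, ∑ j ∈ t, D j z ∂(γ.prod γ) ≤ a := by
      rw [integral_finsetSum _ hDi, ha, ← nsmul_eq_mul]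
      exact Finset.sum_le_card_nsmul _ _ _ hDint
    have h2 : ∫ z, Q z ∂(γ.prod γ)
        = c⁻¹ * (log a - 1 + a⁻¹ * ∫ z, ∑ j ∈ t, D j z ∂(γ.prod γ)) := by
      simp only [hQ]
      rw [integral_const_mul, integral_add (integrable_const _) (hsum.const_mul _),
        integral_const_mul]
      simp
    have h3 : a⁻¹ * ∫ z, ∑ j ∈ t, D j z ∂(γ.prod γ) ≤ 1 := by
      rw [← div_eq_inv_mul, div_le_one ha0]; exact h1
    have h4 : log a = log t.card + c ^ 2 * π ^ 2 / 8 := by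
      rw [ha, log_mul hN.ne' hb0.ne', hbdef, log_exp]
    rw [h2, h4]
    calc _ ≤ c⁻¹ * (log t.card + c ^ 2 * π ^ 2 / 8) := by
          refine mul_le_mul_of_nonneg_left ?_ (by positivity)
          linarith
      _ = _ := by field_simp
  have hpt : ∀ j ∈ t, ∀ z, F j z.2 - F j z.1 ≤ Q z := by
    intro j hj z
    have h1 : D j z ≤ ∑ j ∈ t, D j z :=
      Finset.single_le_sum (f := fun j => D j z) (fun j _ => hDpos j z) hj
    have h2 := log_le_sub_one_of_pos (div_pos (exp_pos (c * (F j z.2 - F j z.1))) ha0)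
    rw [log_div (exp_pos _).ne' ha0.ne', log_exp] at h2
    have h3 : D j z / a ≤ a⁻¹ * ∑ j ∈ t, D j z := by
      rw [← div_eq_inv_mul]; gcongr
    simp only [hQ]
    rw [← div_eq_inv_mul, le_div_iff₀ hc]
    simp only [hD] at h3 ⊢
    linarith
  -- Averaging `F j x - F j y ≤ Q (y, x)` over the independent copy `y` replaces `F j y` by its
  -- mean, which is at most `m`.
  refine ⟨fun x => m + ∫ y, Q (y, x) ∂γ, (integrable_const _).add hQi.integral_prod_right, ?_, ?_⟩
  · intro j hj
    filter_upwards [hQi.prod_left_ae] with x hx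
    have h1 : ∫ y, (F j x - F j y) ∂γ ≤ ∫ y, Q (y, x) ∂γ :=
      integral_mono ((integrable_const _).sub (hint j hj)) hx fun y => hpt j hj (y, x)
    rw [integral_sub (integrable_const _) (hint j hj)] at h1
    simp only [integral_const, probReal_univ, one_smul] at h1
    linarith [hm j hj]
  · rw [integral_add (integrable_const _) hQi.integral_prod_right, ← integral_prod_symm _ hQi]
    simp only [integral_const, probReal_univ, one_smul]
    linarith

/-- The expected maximum of a finite union of finite subsets of the unit ball exceeds the maximum
of the expected maxima over these subsets by at most `log N / c + c π² / 8`, for all `c > 0`. -/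
theorem integral_maxInner_le_of_fibers {ι : Type*} [DecidableEq J] {s : Finset ι}
    (hs : s.Nonempty) {u : ι → E} (hu : ∀ i ∈ s, ‖u i‖ ≤ 1) (κ : ι → J) {m : ℝ}
    (hm : ∀ j (hj : (s.filter (κ · = j)).Nonempty),
      ∫ g, maxInner (s.filter (κ · = j)) hj u g ∂(stdGaussian E) ≤ m) {c : ℝ} (hc : 0 < c) :
    ∫ g, maxInner s hs u g ∂(stdGaussian E)
      ≤ m + log (s.image κ).card / c + c * π ^ 2 / 8 := by
  refine le_of_forall_pos_le_add fun ε hε => ?_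
  have hne : ∀ j ∈ s.image κ, (s.filter (κ · = j)).Nonempty := by
    intro j hj
    obtain ⟨i, hi, rfl⟩ := Finset.mem_image.1 hj
    exact ⟨i, by simp [hi]⟩
  -- Large enough that the smoothing error `log s.card / β` is at most `ε`; the `+ 1` keeps `β`
  -- positive when `s` is a singleton.
  set β : ℝ := (log s.card + 1) / ε with hβdef
  have hlog : 0 ≤ log s.card := log_natCast_nonneg _
  have hβ : 0 < β := by positivity
  obtain ⟨H, hH, hle, hint⟩ := exists_integral_le_and_forall_le (E := E) (hs.image κ)
    (F := fun j => softMax (s.filter (κ · = j)) u β)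
    (F' := fun j g => ∑ i ∈ s.filter (κ · = j), gibbs (s.filter (κ · = j)) u β g i • u i)
    (fun j hj x => hasGradientAt_softMax (hne j hj) u β x hβ.ne')
    (fun j hj => continuous_sum_gibbs_smul (hne j hj) u β)
    (fun j hj x => norm_sum_gibbs_smul_le (hne j hj) u β x
      fun i hi => hu i (Finset.mem_of_mem_filter i hi))
    (fun j hj => integrable_softMax u (hne j hj) hβ) (m := m + ε)
    (fun j hj => by
      refine (integral_softMax_le u (hne j hj) hβ).trans (add_le_add (hm j (hne j hj)) ?_)
      rw [div_le_iff₀ hβ, hβdef, mul_div_cancel₀ _ hε.ne']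
      have : log ((s.filter (κ · = j)).card : ℝ) ≤ log s.card :=
        log_le_log (by exact_mod_cast (hne j hj).card_pos)
          (by exact_mod_cast Finset.card_filter_le _ _)
      linarith) hc
  have hall : ∀ᵐ x ∂(stdGaussian E), maxInner s hs u x ≤ H x := by
    filter_upwards [(Finset.eventually_all (s.image κ)).2 hle] with x hx
    refine (maxInner_le_iff hs u x).2 fun i hi => ?_
    exact (inner_le_softMax u x hβ (by simp [hi])).trans (hx (κ i) (Finset.mem_image_of_mem κ hi))
  linarith [integral_mono_ae (integrable_maxInner hs u) hH hall]

end Concentration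

/-! ### Variance and entropy estimates for probability weights on a finite set. -/

section Weights

open Real
open scoped RealInnerProductSpace

variable {ι E : Type*} [NormedAddCommGroup E] [InnerProductSpace ℝ E] {s : Finset ι}

/-- Twice the variance is the mean squared distance of two independent samples. It converts the
expression produced by integration by parts into pairwise distances, where separation can be used.
-/
theorem sum_sum_mul_norm_sub_sq {p : ι → ℝ} (hp1 : ∑ i ∈ s, p i = 1) (u : ι → E) :
    ∑ i ∈ s, ∑ j ∈ s, p i * p j * ‖u i - u j‖ ^ 2
      = 2 * ∑ i ∈ s, p i * ⟪u i - ∑ j ∈ s, p j • u j, u i⟫ := by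
  have h1 : ∀ i ∈ s, ∑ j ∈ s, p i * p j * ‖u i - u j‖ ^ 2
      = p i * ‖u i‖ ^ 2 - 2 * (p i * ⟪∑ j ∈ s, p j • u j, u i⟫)
        + p i * ∑ j ∈ s, p j * ‖u j‖ ^ 2 := by
    intro i _
    have h2 : ∀ j ∈ s, p i * p j * ‖u i - u j‖ ^ 2
        = p j * (p i * ‖u i‖ ^ 2) - 2 * p i * (p j * ⟪u j, u i⟫) + p i * (p j * ‖u j‖ ^ 2) := by
      intro j _
      rw [norm_sub_sq_real, real_inner_comm]; ring
    rw [Finset.sum_congr rfl h2, Finset.sum_add_distrib, Finset.sum_sub_distrib,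
      ← Finset.sum_mul, ← Finset.mul_sum, ← Finset.mul_sum, hp1, sum_inner]
    simp only [real_inner_smul_left]
    ring
  rw [Finset.sum_congr rfl h1, Finset.sum_add_distrib, Finset.sum_sub_distrib,
    ← Finset.sum_mul, ← Finset.mul_sum, hp1]
  simp only [inner_sub_left, mul_sub, Finset.sum_sub_distrib, real_inner_self_eq_norm_sq]
  ring

/-- `1 - ∑ p i ^ 2` is the probability that two independent samples differ, in which case their
squared distance is at least `t ^ 2`. -/
theorem sq_mul_one_sub_sum_sq_le {p : ι → ℝ} (hp : ∀ i ∈ s, 0 ≤ p i) (hp1 : ∑ i ∈ s, p i = 1)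
    {u : ι → E} {t : ℝ} (ht : 0 ≤ t) (hsep : ∀ i ∈ s, ∀ j ∈ s, i ≠ j → t ≤ ‖u i - u j‖) :
    t ^ 2 * (1 - ∑ i ∈ s, p i ^ 2) ≤ 2 * ∑ i ∈ s, p i * ⟪u i - ∑ j ∈ s, p j • u j, u i⟫ := by
  classical
  rw [← sum_sum_mul_norm_sub_sq hp1]
  have h : ∀ i ∈ s, t ^ 2 * (p i - p i ^ 2) ≤ ∑ j ∈ s, p i * p j * ‖u i - u j‖ ^ 2 := by
    intro i hi
    have h1 : p i - p i ^ 2 = ∑ j ∈ s.erase i, p i * p j := by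
      have h2 := Finset.add_sum_erase s p hi
      have h3 : ∑ j ∈ s.erase i, p j = 1 - p i := by linarith
      rw [← Finset.mul_sum, h3]; ring
    rw [h1, Finset.mul_sum]
    refine (Finset.sum_le_sum fun j hj => ?_).trans
      (Finset.sum_le_sum_of_subset_of_nonneg (Finset.erase_subset i s) fun j hj _ => ?_)
    · have hj' := Finset.mem_erase.1 hj
      have hpp : 0 ≤ p i * p j := mul_nonneg (hp i hi) (hp j hj'.2)
      rw [mul_comm]
      gcongr
      exact hsep i hi j hj'.2 hj'.1.symm
    · exact mul_nonneg (mul_nonneg (hp i hi) (hp j hj)) (sq_nonneg _)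
  calc t ^ 2 * (1 - ∑ i ∈ s, p i ^ 2) = ∑ i ∈ s, t ^ 2 * (p i - p i ^ 2) := by
        rw [← Finset.mul_sum, Finset.sum_sub_distrib, hp1]
    _ ≤ _ := Finset.sum_le_sum h

/-- Entropy well above half its maximal value forces the weights to spread out, that is, a collision
probability `∑ p i ^ 2` bounded away from one. -/
theorem sum_mul_neg_log_le {p : ι → ℝ} (hp : ∀ i ∈ s, 0 < p i) (hp1 : ∑ i ∈ s, p i = 1)
    (hs : 2 ≤ s.card) :
    ∑ i ∈ s, p i * (-log (p i))
      ≤ log s.card / 2 + 3 * log s.card * (1 - ∑ i ∈ s, p i ^ 2) := by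
  classical
  have hne : s.Nonempty := Finset.card_pos.1 (by omega)
  have hN2 : (2 : ℝ) ≤ s.card := by exact_mod_cast hs
  have hN : (0 : ℝ) < s.card := by linarith
  set L := log s.card with hL
  have hL2 : log 2 ≤ L := log_le_log two_pos hN2
  have hlog2 : 0 < log 2 := log_pos one_lt_two
  obtain ⟨k, hk, hmax⟩ := s.exists_max_image p hne
  -- Reference weights for Gibbs' inequality: mass `3 / 4` on a heaviest point `k`, the rest nearly
  -- uniform. Then `-log q` is at most `L / 2` at `k` and at most `3 * L` elsewhere, while `∑ p i ^
  -- 2 ≤ p k`.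
  set q : ι → ℝ := fun i => if i = k then 3 / 4 else (4 * (s.card : ℝ))⁻¹ with hq
  have hqpos : ∀ i, 0 < q i := fun i => by simp only [hq]; split_ifs <;> positivity
  have hqsum : ∑ i ∈ s, q i ≤ 1 := by
    have h1 : ∀ i ∈ s, q i ≤ (if i = k then 3 / 4 else 0) + (4 * (s.card : ℝ))⁻¹ := by
      intro i _
      have : (0 : ℝ) ≤ (4 * (s.card : ℝ))⁻¹ := by positivity
      simp only [hq]; split_ifs <;> linarith
    refine (Finset.sum_le_sum h1).trans ?_
    rw [Finset.sum_add_distrib, Finset.sum_ite_eq' s k, if_pos hk, Finset.sum_const, nsmul_eq_mul]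
    field_simp
    norm_num
  have hgibbs : ∑ i ∈ s, p i * (-log (p i)) ≤ ∑ i ∈ s, p i * (-log (q i)) := by
    have h1 : ∀ i ∈ s, p i * (-log (p i)) ≤ p i * (-log (q i)) + (q i - p i) := by
      intro i hi
      have h2 := log_le_sub_one_of_pos (div_pos (hqpos i) (hp i hi))
      rw [log_div (hqpos i).ne' (hp i hi).ne'] at h2
      have h3 := mul_le_mul_of_nonneg_left h2 (hp i hi).le
      rw [mul_sub (p i) (q i / p i), mul_div_cancel₀ _ (hp i hi).ne'] at h3
      linarith
    refine (Finset.sum_le_sum h1).trans ?_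
    rw [Finset.sum_add_distrib, Finset.sum_sub_distrib, hp1]
    linarith
  have hlogq : ∀ i ∈ s, p i * (-log (q i)) ≤ p i * (3 * L) - if i = k then p i * (5 / 2 * L) else 0 := by
    intro i hi
    simp only [hq]
    split_ifs with h
    · have h1 : -log (3 / 4) ≤ log 2 / 2 := by
        -- The argument of the logarithm is `9 / 8`.
        have h2 : log (2 * (3 / 4 : ℝ) ^ 2) ≥ 0 := log_nonneg (by norm_num)
        rw [log_mul (by norm_num) (by norm_num), log_pow] at h2
        push_cast at h2
        linarith
      have h2 := mul_le_mul_of_nonneg_left (h1.trans (by linarith : log 2 / 2 ≤ L / 2)) (hp i hi).le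
      linarith
    · rw [log_inv, neg_neg, log_mul (by norm_num) hN.ne', sub_zero]
      have h4 : log 4 = 2 * log 2 := by
        rw [show (4 : ℝ) = 2 ^ 2 by norm_num, log_pow]; push_cast; rfl
      refine mul_le_mul_of_nonneg_left ?_ (hp i hi).le
      rw [h4]; linarith
  have hpk : ∑ i ∈ s, p i ^ 2 ≤ p k := by
    calc ∑ i ∈ s, p i ^ 2 ≤ ∑ i ∈ s, p i * p k := Finset.sum_le_sum fun i hi => by
          rw [sq]; exact mul_le_mul_of_nonneg_left (hmax i hi) (hp i hi).le
      _ = p k := by rw [← Finset.sum_mul, hp1, one_mul]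
  have hpk1 : p k ≤ 1 := hp1 ▸ Finset.single_le_sum (fun i hi => (hp i hi).le) hk
  refine hgibbs.trans ((Finset.sum_le_sum hlogq).trans ?_)
  rw [Finset.sum_sub_distrib, ← Finset.sum_mul, hp1, Finset.sum_ite_eq' s k, if_pos hk]
  have h1 : L * (∑ i ∈ s, p i ^ 2) ≤ L * p k := mul_le_mul_of_nonneg_left hpk (by linarith)
  have h2 : L * p k ≤ L * 1 := mul_le_mul_of_nonneg_left hpk1 (by linarith)
  linarith

/-- The log-partition function equals `β` times the Gibbs mean plus the entropy of the Gibbs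
weights; the entropy bound is inserted. -/
theorem log_partitionFn_le (hs : 2 ≤ s.card) (u : ι → E) (β : ℝ) (g : E) :
    log (partitionFn s u β g) ≤ β * ∑ i ∈ s, gibbs s u β g i * ⟪g, u i⟫
      + (log s.card / 2 + 3 * log s.card * (1 - ∑ i ∈ s, gibbs s u β g i ^ 2)) := by
  have hne : s.Nonempty := Finset.card_pos.1 (by omega)
  have hZ := partitionFn_pos hne u β g
  have h := sum_mul_neg_log_le (p := gibbs s u β g) (fun i _ => div_pos (exp_pos _) hZ)
    (sum_gibbs hne u β g) hs
  have h1 : ∀ i ∈ s, gibbs s u β g i * (-log (gibbs s u β g i))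
      = gibbs s u β g i * log (partitionFn s u β g) - β * (gibbs s u β g i * ⟪g, u i⟫) := by
    intro i _
    have : log (gibbs s u β g i) = β * ⟪g, u i⟫ - log (partitionFn s u β g) := by
      rw [gibbs, log_div (exp_pos _).ne' hZ.ne', log_exp]
    rw [this]; ring
  rw [Finset.sum_congr rfl h1, Finset.sum_sub_distrib, ← Finset.sum_mul, sum_gibbs hne, one_mul,
    ← Finset.mul_sum] at h
  linarith

/-- Jensen for `exp` under the uniform weights. The linear term has Gaussian mean zero, so the
expected log-partition function is at least `log s.card`. -/
theorem le_log_partitionFn (hs : s.Nonempty) (u : ι → E) (β : ℝ) (g : E) :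
    log s.card + (s.card : ℝ)⁻¹ * (β * ∑ i ∈ s, ⟪g, u i⟫) ≤ log (partitionFn s u β g) := by
  have hN : (0 : ℝ) < s.card := by exact_mod_cast hs.card_pos
  set A := (s.card : ℝ)⁻¹ * (β * ∑ i ∈ s, ⟪g, u i⟫) with hA
  rw [le_log_iff_exp_le (partitionFn_pos hs u β g), exp_add, exp_log hN]
  have h1 : ∀ i ∈ s, exp A * (1 - A) + exp A * (β * ⟪g, u i⟫) ≤ exp (β * ⟪g, u i⟫) := by
    intro i _
    have h2 := add_one_le_exp (β * ⟪g, u i⟫ - A)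
    have h3 := mul_le_mul_of_nonneg_left h2 (exp_pos A).le
    rw [← exp_add, add_sub_cancel] at h3
    linarith
  have h2 := Finset.sum_le_sum h1
  rw [Finset.sum_add_distrib, Finset.sum_const, nsmul_eq_mul, ← Finset.mul_sum,
    ← Finset.mul_sum] at h2
  have h3 : β * ∑ i ∈ s, ⟪g, u i⟫ = s.card * A := by rw [hA]; field_simp
  rw [h3] at h2
  refine le_trans (le_of_eq ?_) h2
  ring

end Weights

/-! ### Sudakov minoration through Gibbs weights. -/

section Sudakov

open Real
open scoped RealInnerProductSpace

variable {ι E : Type*} [NormedAddCommGroup E] [InnerProductSpace ℝ E]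
  [FiniteDimensional ℝ E] [MeasurableSpace E] [BorelSpace E] {s : Finset ι}

theorem integrable_gibbs_mul_inner (hs : s.Nonempty) (u : ι → E) (β : ℝ) {i : ι} (hi : i ∈ s) :
    Integrable (fun g => gibbs s u β g i * ⟪g, u i⟫) (stdGaussian E) :=
  (integrable_inner_stdGaussian (u i)).bdd_mul (c := 1)
    (continuous_gibbs hs u β i).aestronglyMeasurable
    (Filter.Eventually.of_forall fun g => by
      rw [Real.norm_eq_abs, abs_of_nonneg (gibbs_nonneg hs u β g i)]
      exact gibbs_le_one hs u β g hi)

/-- Integration by parts applied to one Gibbs weight, whose gradient is proportional to the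
deviation of `u i` from the Gibbs mean. -/
theorem integral_gibbs_mul_inner (hs : s.Nonempty) (u : ι → E) (β : ℝ) {i : ι} (hi : i ∈ s) :
    ∫ g, gibbs s u β g i * ⟪g, u i⟫ ∂(stdGaussian E)
      = β * ∫ g, gibbs s u β g i * ⟪u i - ∑ j ∈ s, gibbs s u β g j • u j, u i⟫
          ∂(stdGaussian E) := by
  set B := ∑ i ∈ s, ‖u i‖ with hB
  have hB0 : 0 ≤ B := Finset.sum_nonneg fun _ _ => norm_nonneg _
  have hu : ∀ j ∈ s, ‖u j‖ ≤ B := fun j hj =>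
    Finset.single_le_sum (f := fun j => ‖u j‖) (fun _ _ => norm_nonneg _) hj
  have h := integral_mul_inner_stdGaussian (M := 1 + |β| * (2 * B))
    (fun g => hasGradientAt_gibbs hs u β g i)
    (by
      have h1 := continuous_gibbs hs u β i
      have h2 := continuous_sum_gibbs_smul hs u β
      fun_prop)
    (fun g => by
      rw [abs_of_nonneg (gibbs_nonneg hs u β g i)]
      have := gibbs_le_one hs u β g hi
      have : 0 ≤ |β| * (2 * B) := by positivity
      linarith)
    (fun g => by
      rw [norm_smul, norm_mul, Real.norm_eq_abs, Real.norm_eq_abs,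
        abs_of_nonneg (gibbs_nonneg hs u β g i)]
      have h1 := gibbs_le_one hs u β g hi
      have h2 : ‖u i - ∑ j ∈ s, gibbs s u β g j • u j‖ ≤ 2 * B :=
        (norm_sub_le _ _).trans (by
          linarith [hu i hi, norm_sum_gibbs_smul_le hs u β g hu])
      have h3 : |β| * gibbs s u β g i ≤ |β| :=
        mul_le_of_le_one_right (abs_nonneg _) h1
      have h4 : |β| * gibbs s u β g i * ‖u i - ∑ j ∈ s, gibbs s u β g j • u j‖ ≤ |β| * (2 * B) :=
        mul_le_mul h3 h2 (norm_nonneg _) (abs_nonneg _)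
      linarith) (u i)
  simp only [real_inner_comm (u i)] at h
  simp only [real_inner_comm (u i)]
  rw [h, ← integral_const_mul]
  refine integral_congr_ae (Filter.Eventually.of_forall fun g => ?_)
  simp only [real_inner_smul_right]
  ring

/-- **Sudakov minoration.** -/
theorem mul_sqrt_log_card_le_integral_maxInner (hs : s.Nonempty) {u : ι → E} {t : ℝ} (ht : 0 < t)
    (hsep : ∀ i ∈ s, ∀ j ∈ s, i ≠ j → t ≤ ‖u i - u j‖) :
    t * √(log s.card) ≤ 14 * ∫ g, maxInner s hs u g ∂(stdGaussian E) := by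
  set γ := stdGaussian E
  set W := ∫ g, maxInner s hs u g ∂γ with hW
  have hW0 : 0 ≤ W := integral_maxInner_nonneg hs u
  rcases lt_or_ge s.card 2 with hcard | hcard
  · have h1 : s.card = 1 := by have := hs.card_pos; omega
    simp only [h1, Nat.cast_one, log_one, sqrt_zero, mul_zero]
    positivity
  set L := log s.card with hL
  have hLpos : 0 < L := log_pos (by exact_mod_cast hcard)
  set r := √L with hr
  have hrpos : 0 < r := sqrt_pos.2 hLpos
  have hrL : r ^ 2 = L := sq_sqrt hLpos.le
  -- With `W` the expected maximum and `q = 1 - ∑ p i ^ 2`, integration by parts and separation give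
  -- `β t ^ 2 E[q] ≤ 2 W`, while the entropy bound gives `L / 2 ≤ β W + 3 L E[q]`. This `β` makes
  -- both terms on the right multiples of `r W / t`.
  set β := r / t with hβdef
  have hβ : 0 < β := div_pos hrpos ht
  set p : ι → E → ℝ := fun i g => gibbs s u β g i with hp
  have hpc : ∀ i, Continuous (p i) := fun i => continuous_gibbs hs u β i
  set A : E → ℝ := fun g => ∑ i ∈ s, p i g * ⟪g, u i⟫ with hA
  set q : E → ℝ := fun g => 1 - ∑ i ∈ s, p i g ^ 2 with hq
  have hAi : Integrable A γ :=
    integrable_finsetSum _ fun i hi => integrable_gibbs_mul_inner hs u β hi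
  have hqi : Integrable q γ := by
    refine Integrable.of_bound (C := 1) (by fun_prop : Continuous q).aestronglyMeasurable
      (Filter.Eventually.of_forall fun g => ?_)
    have h0 : 0 ≤ ∑ i ∈ s, p i g ^ 2 := Finset.sum_nonneg fun i _ => sq_nonneg _
    have h1 : ∑ i ∈ s, p i g ^ 2 ≤ 1 := by
      rw [← sum_gibbs hs u β g]
      refine Finset.sum_le_sum fun i hi => ?_
      have := gibbs_le_one hs u β g hi
      have := gibbs_nonneg hs u β g i
      simp only [hp]; nlinarith
    rw [Real.norm_eq_abs, abs_le]
    constructor <;> simp only [hq] <;> linarith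
  have hAW : ∫ g, A g ∂γ ≤ W := by
    refine integral_mono hAi (integrable_maxInner hs u) fun g => ?_
    calc A g ≤ ∑ i ∈ s, p i g * maxInner s hs u g := Finset.sum_le_sum fun i hi =>
          mul_le_mul_of_nonneg_left (inner_le_maxInner hs u g hi) (gibbs_nonneg hs u β g i)
      _ = _ := by rw [← Finset.sum_mul, sum_gibbs hs, one_mul]
  have hVi : ∀ i ∈ s,
      Integrable (fun g => p i g * ⟪u i - ∑ j ∈ s, p j g • u j, u i⟫) γ := by
    intro i hi
    set B := ∑ i ∈ s, ‖u i‖ with hB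
    have hu : ∀ j ∈ s, ‖u j‖ ≤ B := fun j hj =>
      Finset.single_le_sum (f := fun j => ‖u j‖) (fun _ _ => norm_nonneg _) hj
    have hB0 : 0 ≤ B := Finset.sum_nonneg fun _ _ => norm_nonneg _
    refine Integrable.of_bound (C := 2 * B * B)
      (by fun_prop : Continuous _).aestronglyMeasurable
      (Filter.Eventually.of_forall fun g => ?_)
    rw [norm_mul, Real.norm_eq_abs, abs_of_nonneg (gibbs_nonneg hs u β g i)]
    refine (mul_le_of_le_one_left (norm_nonneg _) (gibbs_le_one hs u β g hi)).trans ?_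
    refine (norm_inner_le_norm _ _).trans ?_
    have h2 : ‖u i - ∑ j ∈ s, gibbs s u β g j • u j‖ ≤ 2 * B :=
      (norm_sub_le _ _).trans (by
        linarith [hu i hi, norm_sum_gibbs_smul_le hs u β g hu])
    exact mul_le_mul h2 (hu i hi) (norm_nonneg _) (by positivity)
  have hAq : β * t ^ 2 * ∫ g, q g ∂γ ≤ 2 * ∫ g, A g ∂γ := by
    have h1 : ∫ g, A g ∂γ
        = β * ∫ g, ∑ i ∈ s, p i g * ⟪u i - ∑ j ∈ s, p j g • u j, u i⟫ ∂γ := by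
      simp only [hA]
      rw [integral_finsetSum _ fun i hi => integrable_gibbs_mul_inner hs u β hi,
        integral_finsetSum _ hVi, Finset.mul_sum]
      exact Finset.sum_congr rfl fun i hi => integral_gibbs_mul_inner hs u β hi
    have h2 : ∫ g, t ^ 2 * q g ∂γ
        ≤ ∫ g, 2 * ∑ i ∈ s, p i g * ⟪u i - ∑ j ∈ s, p j g • u j, u i⟫ ∂γ :=
      integral_mono (hqi.const_mul _) ((integrable_finsetSum _ hVi).const_mul _) fun g =>
        sq_mul_one_sub_sum_sq_le (fun i _ => gibbs_nonneg hs u β g i) (sum_gibbs hs u β g)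
          ht.le hsep
    rw [integral_const_mul, integral_const_mul] at h2
    rw [h1]
    nlinarith
  have hent : L ≤ β * ∫ g, A g ∂γ + (L / 2 + 3 * L * ∫ g, q g ∂γ) := by
    have hl : Integrable (fun g => L + (s.card : ℝ)⁻¹ * (β * ∑ i ∈ s, ⟪g, u i⟫)) γ :=
      (integrable_const _).add (((integrable_finsetSum _ fun i _ =>
        integrable_inner_stdGaussian (u i)).const_mul _).const_mul _)
    have h1 : ∫ g, (L + (s.card : ℝ)⁻¹ * (β * ∑ i ∈ s, ⟪g, u i⟫)) ∂γ = L := by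
      rw [integral_add (integrable_const _) (((integrable_finsetSum _ fun i _ =>
        integrable_inner_stdGaussian (u i)).const_mul _).const_mul _), integral_const_mul,
        integral_const_mul, integral_finsetSum _ fun i _ => integrable_inner_stdGaussian (u i)]
      simp [integral_inner_stdGaussian]
    have h2 : ∫ g, (β * A g + (L / 2 + 3 * L * q g)) ∂γ
        = β * ∫ g, A g ∂γ + (L / 2 + 3 * L * ∫ g, q g ∂γ) := by
      have hq' : Integrable (fun g => L / 2 + 3 * L * q g) γ :=
        (integrable_const _).add (hqi.const_mul _)
      rw [integral_add (hAi.const_mul _) hq', integral_add (integrable_const _) (hqi.const_mul _),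
        integral_const_mul, integral_const_mul]
      simp
    calc L = ∫ g, (L + (s.card : ℝ)⁻¹ * (β * ∑ i ∈ s, ⟪g, u i⟫)) ∂γ := h1.symm
      _ ≤ ∫ g, (β * A g + (L / 2 + 3 * L * q g)) ∂γ :=
        integral_mono hl ((hAi.const_mul _).add ((integrable_const _).add (hqi.const_mul _)))
          fun g => (le_log_partitionFn hs u β g).trans (log_partitionFn_le hcard u β g)
      _ = _ := h2
  set a := ∫ g, A g ∂γ
  set b := ∫ g, q g ∂γ
  have e1 : r * t * b ≤ 2 * W := by
    have : β * t ^ 2 = r * t := by rw [hβdef]; field_simp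
    rw [this] at hAq
    linarith
  have e2 : r ^ 2 * t ≤ 2 * (r * a) + 6 * r ^ 2 * t * b := by
    have h3 := mul_le_mul_of_nonneg_left hent ht.le
    have h4 : t * (β * a) = r * a := by rw [hβdef]; field_simp
    rw [mul_add, h4, ← hrL] at h3
    nlinarith
  -- In `e2`, `a ≤ W` contributes `2 r W` and `r t b ≤ 2 W` contributes `12 r W`.
  have e3 : r * (t * r) ≤ r * (14 * W) := by nlinarith
  exact le_of_mul_le_mul_left e3 hrpos

end Sudakov

/-! ### Mean width of arbitrary sets through finite subsets. -/

section MeanWidth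

open Real
open scoped RealInnerProductSpace

variable {p : ℕ} {A : Set (EuclideanSpace ℝ (Fin p))}

theorem measurable_supInner : Measurable (supInner A) := by
  have : LowerSemicontinuous (supInner A) :=
    lowerSemicontinuous_biSup fun v _ => (continuous_coe_real_ereal.comp
      (by fun_prop : Continuous fun g : EuclideanSpace ℝ (Fin p) => (⟪g, v⟫ : ℝ))).lowerSemicontinuous
  exact this.measurable

/-- This is `sup = sup_{v ∈ A} ⟪g, v - a⟫ + ⟪g, a⟫`, split into positive and negative parts and
rearranged without subtraction, so that it holds in `[0, ∞]` even when the supremum is infinite. -/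
theorem supInner_toENNReal_add {a : EuclideanSpace ℝ (Fin p)} (ha : a ∈ A)
    (g : EuclideanSpace ℝ (Fin p)) :
    (supInner A g).toENNReal + ENNReal.ofReal (-⟪g, a⟫)
      = (⨆ v ∈ A, ENNReal.ofReal ⟪g, v - a⟫) + ENNReal.ofReal ⟪g, a⟫
        + (-supInner A g).toENNReal := by
  set Y : ℝ≥0∞ := ⨆ v ∈ A, ENNReal.ofReal ⟪g, v - a⟫ with hY
  have hle : ∀ v ∈ A, ((⟪g, v⟫ : ℝ) : EReal) ≤ supInner A g := fun v hv =>
    le_iSup₂_of_le v hv le_rfl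
  by_cases hX : supInner A g = ⊤
  · have hYtop : Y = ⊤ := by
      by_contra hne
      have h1 : supInner A g ≤ ((⟪g, a⟫ + Y.toReal : ℝ) : EReal) := by
        refine iSup₂_le fun v hv => EReal.coe_le_coe_iff.2 ?_
        have h2 : ENNReal.ofReal ⟪g, v - a⟫ ≤ Y := le_iSup₂_of_le v hv le_rfl
        have h3 := (ENNReal.ofReal_le_iff_le_toReal hne).1 h2
        rw [inner_sub_right] at h3
        linarith
      rw [hX, top_le_iff] at h1
      exact EReal.coe_ne_top _ h1
    simp [hX, hYtop]
  · have hbot : supInner A g ≠ ⊥ := fun h => by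
      have := hle a ha
      rw [h, le_bot_iff] at this
      exact EReal.coe_ne_bot _ this
    obtain ⟨x, hx⟩ : ∃ x : ℝ, supInner A g = x := ⟨_, (EReal.coe_toReal hX hbot).symm⟩
    have hvx : ∀ v ∈ A, ⟪g, v⟫ ≤ x := fun v hv => by
      have := hle v hv
      rw [hx] at this
      exact EReal.coe_le_coe_iff.1 this
    have hYle : Y ≤ ENNReal.ofReal (x - ⟪g, a⟫) := by
      refine iSup₂_le fun v hv => ENNReal.ofReal_le_ofReal ?_
      rw [inner_sub_right]
      linarith [hvx v hv]
    have hne : Y ≠ ⊤ := (hYle.trans_lt ENNReal.ofReal_lt_top).ne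
    have hYge : ENNReal.ofReal (x - ⟪g, a⟫) ≤ Y := by
      rw [ENNReal.ofReal_le_iff_le_toReal hne, sub_le_iff_le_add, ← EReal.coe_le_coe_iff, ← hx]
      refine iSup₂_le fun v hv => EReal.coe_le_coe_iff.2 ?_
      have h2 : ENNReal.ofReal ⟪g, v - a⟫ ≤ Y := le_iSup₂_of_le v hv le_rfl
      have h3 := (ENNReal.ofReal_le_iff_le_toReal hne).1 h2
      rw [inner_sub_right] at h3
      linarith
    rw [le_antisymm hYle hYge, hx, ← EReal.coe_neg, EReal.real_coe_toENNReal,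
      EReal.real_coe_toENNReal]
    have hmax : ∀ y : ℝ, ENNReal.ofReal y = ENNReal.ofReal (max y 0) := fun y => by
      simp [ENNReal.ofReal_max]
    rw [hmax x, hmax (-⟪g, a⟫), hmax (x - _), hmax ⟪g, a⟫, hmax (-x),
      ← ENNReal.ofReal_add (le_max_right _ _) (le_max_right _ _),
      ← ENNReal.ofReal_add (le_max_right _ _) (le_max_right _ _),
      ← ENNReal.ofReal_add (add_nonneg (le_max_right _ _) (le_max_right _ _)) (le_max_right _ _)]
    congr 1
    have h1 := max_zero_sub_eq_self x
    have h2 := max_zero_sub_eq_self ⟪g, a⟫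
    rw [max_eq_left (sub_nonneg.2 (hvx a ha)), max_comm (-⟪g, a⟫), max_comm (-x), max_comm x,
      max_comm ⟪g, a⟫]
    simp only [max_comm _ (0 : ℝ)] at h1 h2 ⊢
    linarith

/-- The mean width as the integral of a nonnegative function. -/
theorem meanWidth_eq_lintegral {a : EuclideanSpace ℝ (Fin p)} (ha : a ∈ A) :
    meanWidth A = ∫⁻ g, ⨆ v ∈ A, ENNReal.ofReal ⟪g, v - a⟫
      ∂(stdGaussian (EuclideanSpace ℝ (Fin p))) := by
  set γ := stdGaussian (EuclideanSpace ℝ (Fin p))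
  have hB := lintegral_neg_supInner_lt_top ⟨a, ha⟩
  have hid := integrable_inner_stdGaussian a
  have hbal : ∫⁻ g, ENNReal.ofReal (-⟪g, a⟫) ∂γ = ∫⁻ g, ENNReal.ofReal ⟪g, a⟫ ∂γ := by
    have h := integral_eq_lintegral_pos_part_sub_lintegral_neg_part hid
    rw [integral_inner_stdGaussian, eq_comm, sub_eq_zero] at h
    exact ((ENNReal.toReal_eq_toReal_iff' hid.lintegral_lt_top.ne
      hid.neg.lintegral_lt_top.ne).1 h).symm
  have hmeas : Measurable fun g => (-supInner A g).toENNReal :=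
    (measurable_supInner.neg).ereal_toENNReal
  have h := lintegral_congr (μ := γ) (supInner_toENNReal_add ha)
  rw [lintegral_add_right _ (by fun_prop), lintegral_add_right _ hmeas,
    lintegral_add_right _ (by fun_prop), hbal, add_right_comm] at h
  have h2 := (ENNReal.add_left_inj hid.lintegral_lt_top.ne).1 h
  rw [meanWidth, extExpectation, h2, EReal.coe_ennreal_add, add_sub_assoc, EReal.sub_self,
    add_zero, EReal.toENNReal_coe]
  · simpa using hB.ne
  · simp

theorem ofReal_integral_maxInner {ι : Type*} {s : Finset ι} (hs : s.Nonempty)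
    (u : ι → EuclideanSpace ℝ (Fin p)) {i : ι} (hi : i ∈ s) :
    ENNReal.ofReal (∫ g, maxInner s hs u g ∂(stdGaussian (EuclideanSpace ℝ (Fin p))))
      = ∫⁻ g, ENNReal.ofReal (maxInner s hs u g - ⟪g, u i⟫)
          ∂(stdGaussian (EuclideanSpace ℝ (Fin p))) := by
  have hint := (integrable_maxInner hs u).sub (integrable_inner_stdGaussian (u i))
  have h := integral_sub (integrable_maxInner hs u) (integrable_inner_stdGaussian (u i))
  rw [integral_inner_stdGaussian, sub_zero] at h
  rw [← h]
  exact ofReal_integral_eq_lintegral_ofReal hint (Filter.Eventually.of_forall fun g =>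
    sub_nonneg.2 (inner_le_maxInner hs u g hi))

theorem ofReal_integral_maxInner_le_meanWidth {ι : Type*} {s : Finset ι} (hs : s.Nonempty)
    {u : ι → EuclideanSpace ℝ (Fin p)} (hu : ∀ i ∈ s, u i ∈ A) :
    ENNReal.ofReal (∫ g, maxInner s hs u g ∂(stdGaussian (EuclideanSpace ℝ (Fin p))))
      ≤ meanWidth A := by
  obtain ⟨i, hi⟩ := id hs
  rw [ofReal_integral_maxInner hs u hi, meanWidth_eq_lintegral (hu i hi)]
  refine lintegral_mono fun g => ?_
  obtain ⟨j, hj, hmax⟩ := s.exists_mem_eq_sup' hs fun i => ⟪g, u i⟫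
  refine le_iSup₂_of_le (u j) (hu j hj) ?_
  rw [maxInner, hmax, inner_sub_right]

theorem integral_maxInner_le_toReal_meanWidth {ι : Type*} {s : Finset ι} (hs : s.Nonempty)
    {u : ι → EuclideanSpace ℝ (Fin p)} (hu : ∀ i ∈ s, u i ∈ A) (hA : meanWidth A ≠ ∞) :
    ∫ g, maxInner s hs u g ∂(stdGaussian (EuclideanSpace ℝ (Fin p))) ≤ (meanWidth A).toReal :=
  (ENNReal.ofReal_le_iff_le_toReal hA).1 (ofReal_integral_maxInner_le_meanWidth hs hu)

/-- The mean width is the supremum of the expected maxima over finite subsets. -/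
theorem meanWidth_le_of_forall_finset {c : ℝ≥0∞}
    (hc : ∀ (s : Finset (EuclideanSpace ℝ (Fin p))) (hs : s.Nonempty), ↑s ⊆ A →
      ENNReal.ofReal (∫ g, maxInner s hs id g ∂(stdGaussian (EuclideanSpace ℝ (Fin p)))) ≤ c) :
    meanWidth A ≤ c := by
  classical
  rcases A.eq_empty_or_nonempty with rfl | ⟨a, ha⟩
  · simp [meanWidth_empty]
  have : Nonempty A := ⟨⟨a, ha⟩⟩
  obtain ⟨f, hf⟩ := TopologicalSpace.exists_dense_seq A
  -- Increasing finite pieces of a countable dense subset of `A`. Each contains the base point `a`,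
  -- so the shifted maxima are nonnegative and monotone convergence applies.
  set S : ℕ → Finset (EuclideanSpace ℝ (Fin p)) := fun n =>
    insert a ((Finset.range n).image fun k => (f k : EuclideanSpace ℝ (Fin p))) with hS
  have haS : ∀ n, a ∈ S n := fun n => Finset.mem_insert_self _ _
  have hSne : ∀ n, (S n).Nonempty := fun n => ⟨a, haS n⟩
  have hSA : ∀ n, (↑(S n) : Set (EuclideanSpace ℝ (Fin p))) ⊆ A := by
    intro n v hv
    simp only [hS, Finset.coe_insert, Finset.coe_image, Set.mem_insert_iff, Set.mem_image] at hv
    rcases hv with rfl | ⟨k, _, rfl⟩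
    · exact ha
    · exact (f k).2
  set h : ℕ → EuclideanSpace ℝ (Fin p) → ℝ≥0∞ := fun n g =>
    ENNReal.ofReal (maxInner (S n) (hSne n) id g - ⟪g, a⟫) with hh
  have hmono : Monotone h := by
    intro m n hmn g
    refine ENNReal.ofReal_le_ofReal (sub_le_sub_right ?_ _)
    exact Finset.sup'_mono _ (Finset.insert_subset_insert _ (Finset.image_subset_image
      (Finset.range_subset_range.2 hmn))) _
  have hmeas : ∀ n, Measurable (h n) := fun n =>
    ((continuous_maxInner (hSne n) id).sub (by fun_prop)).measurable.ennreal_ofReal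
  rw [meanWidth_eq_lintegral ha]
  calc _ ≤ ∫⁻ g, ⨆ n, h n g ∂(stdGaussian (EuclideanSpace ℝ (Fin p))) := by
        refine lintegral_mono fun g => iSup₂_le fun v hv => ?_
        have hcl : IsClosed {w : A | ENNReal.ofReal ⟪g, (w : EuclideanSpace ℝ (Fin p)) - a⟫
            ≤ ⨆ n, h n g} :=
          isClosed_le (ENNReal.continuous_ofReal.comp (by fun_prop)) continuous_const
        refine hf.induction_on (p := fun w : A => ENNReal.ofReal
          ⟪g, (w : EuclideanSpace ℝ (Fin p)) - a⟫ ≤ ⨆ n, h n g) ⟨v, hv⟩ hcl fun k => ?_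
        have hk : (f k : EuclideanSpace ℝ (Fin p)) ∈ S (k + 1) :=
          Finset.mem_insert_of_mem
            (Finset.mem_image_of_mem (fun k => (f k : EuclideanSpace ℝ (Fin p)))
              (Finset.self_mem_range_succ k))
        have hle : ENNReal.ofReal ⟪g, (f k : EuclideanSpace ℝ (Fin p)) - a⟫ ≤ h (k + 1) g := by
          rw [inner_sub_right]
          exact ENNReal.ofReal_le_ofReal
            (sub_le_sub_right (inner_le_maxInner (hSne (k + 1)) id g hk) _)
        exact hle.trans (le_iSup (fun n => h n g) (k + 1))
    _ = ⨆ n, ∫⁻ g, h n g ∂(stdGaussian (EuclideanSpace ℝ (Fin p))) := lintegral_iSup hmeas hmono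
    _ ≤ c := by
        refine iSup_le fun n => ?_
        have := hc (S n) (hSne n) (hSA n)
        rwa [ofReal_integral_maxInner (hSne n) id (haS n)] at this

end MeanWidth

/-! ### Nets and the two local mean width bounds. -/

section LocalMeanWidth

open Real
open scoped RealInnerProductSpace

variable {p : ℕ}

/-- A set of finite mean width has a finite `t`-net whose cardinality obeys Sudakov's bound. -/
theorem exists_net_of_meanWidth_ne_top {R : Set (EuclideanSpace ℝ (Fin p))}
    (hR : R.Nonempty) (hw : meanWidth R ≠ ∞) {t : ℝ} (ht : 0 < t) :
    ∃ N : Finset (EuclideanSpace ℝ (Fin p)), N.Nonempty ∧ ↑N ⊆ R ∧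
      (∀ x ∈ R, ∃ y ∈ N, ‖x - y‖ ≤ t) ∧ t * √(log N.card) ≤ 14 * (meanWidth R).toReal := by
  classical
  set W := (meanWidth R).toReal
  set P : Finset (EuclideanSpace ℝ (Fin p)) → Prop := fun N =>
    N.Nonempty ∧ ↑N ⊆ R ∧ ∀ x ∈ N, ∀ y ∈ N, x ≠ y → t ≤ ‖x - y‖ with hP
  have hsud : ∀ N, P N → t * √(log N.card) ≤ 14 * W := by
    rintro N ⟨hN, hNR, hsep⟩
    refine (mul_sqrt_log_card_le_integral_maxInner hN (u := id) ht hsep).trans ?_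
    gcongr
    exact integral_maxInner_le_toReal_meanWidth hN (fun i hi => hNR hi) hw
  -- Sudakov bounds the size of every `t`-separated subset of `R` by `B`, so one of largest size
  -- exists; by maximality it is a `t`-net.
  set B := ⌈exp ((14 * W / t) ^ 2)⌉₊
  have hcard : ∀ N, P N → N.card ≤ B := by
    intro N hN
    have h1 : √(log N.card) ≤ 14 * W / t := by
      rw [le_div_iff₀ ht, mul_comm]; exact hsud N hN
    have h2 := (sqrt_le_left (h1.trans' (sqrt_nonneg _))).1 h1
    rw [log_le_iff_le_exp (by exact_mod_cast hN.1.card_pos)] at h2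
    exact_mod_cast h2.trans (Nat.le_ceil _)
  obtain ⟨x₀, hx₀⟩ := hR
  have hex : ∃ n, ∃ N, P N ∧ N.card = n := ⟨1, {x₀}, ⟨by simp, by simpa using hx₀, by simp⟩, by simp⟩
  obtain ⟨n, hn, hmax⟩ : ∃ n, (∃ N, P N ∧ N.card = n) ∧ ∀ m, (∃ N, P N ∧ N.card = m) → m ≤ n := by
    have hbdd : ∀ m, (∃ N, P N ∧ N.card = m) → m ≤ B := by
      rintro m ⟨N, hN, rfl⟩; exact hcard N hN
    obtain ⟨k, hk⟩ := hex
    exact ⟨Nat.findGreatest (fun m => ∃ N, P N ∧ N.card = m) B,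
      Nat.findGreatest_spec (P := fun m => ∃ N, P N ∧ N.card = m) (hbdd k hk) hk, fun m hm => Nat.le_findGreatest (hbdd m hm) hm⟩
  obtain ⟨N, hN, rfl⟩ := hn
  refine ⟨N, hN.1, hN.2.1, fun x hx => ?_, hsud N hN⟩
  by_contra! hfar
  have hxN : x ∉ N := fun h => by
    have := hfar x h
    simp at this
    linarith
  have hins : P (insert x N) := by
    refine ⟨Finset.insert_nonempty _ _, ?_, ?_⟩
    · rw [Finset.coe_insert]; exact Set.insert_subset hx hN.2.1
    · intro a ha b hb hab
      rcases Finset.mem_insert.1 ha with rfl | ha' <;> rcases Finset.mem_insert.1 hb with rfl | hb'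
      · exact absurd rfl hab
      · exact (hfar b hb').le
      · rw [norm_sub_rev]; exact (hfar a ha').le
      · exact hN.2.2 a ha' b hb' hab
  have := hmax _ ⟨_, hins, rfl⟩
  rw [Finset.card_insert_of_notMem hxN] at this
  omega

/-- Optimized form of `integral_maxInner_le_of_fibers`. -/
theorem integral_maxInner_le_add_sqrt_log {ι J : Type*} [DecidableEq J] {s : Finset ι}
    (hs : s.Nonempty) {u : ι → EuclideanSpace ℝ (Fin p)} (hu : ∀ i ∈ s, ‖u i‖ ≤ 1)
    {N : Finset J} {κ : ι → J} (hκ : ∀ i ∈ s, κ i ∈ N) {m : ℝ}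
    (hm : ∀ j (hj : (s.filter (κ · = j)).Nonempty),
      ∫ g, maxInner (s.filter (κ · = j)) hj u g ∂(stdGaussian (EuclideanSpace ℝ (Fin p))) ≤ m) :
    ∫ g, maxInner s hs u g ∂(stdGaussian (EuclideanSpace ℝ (Fin p))) ≤ m + 3 * √(log N.card) := by
  have hle : ∀ c : ℝ, 0 < c →
      ∫ g, maxInner s hs u g ∂(stdGaussian (EuclideanSpace ℝ (Fin p)))
        ≤ m + log N.card / c + 2 * c := by
    intro c hc
    refine (integral_maxInner_le_of_fibers hs hu κ hm hc).trans ?_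
    have h1 : log ((s.image κ).card : ℝ) ≤ log N.card :=
      log_le_log (by exact_mod_cast (hs.image κ).card_pos)
        (by exact_mod_cast Finset.card_le_card (Finset.image_subset_iff.2 hκ))
    have h2 : π ^ 2 ≤ 16 := by nlinarith [pi_pos, pi_le_four]
    have h3 : c * π ^ 2 ≤ c * 16 := by gcongr
    have h4 : log ((s.image κ).card : ℝ) / c ≤ log N.card / c := by gcongr
    linarith
  have hL : 0 ≤ log (N.card : ℝ) := log_natCast_nonneg _
  rcases hL.eq_or_lt with h0 | hpos
  · rw [← h0, sqrt_zero, mul_zero, add_zero]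
    refine le_of_forall_pos_le_add fun ε hε => ?_
    have := hle (ε / 2) (by positivity)
    rw [← h0, zero_div] at this
    linarith
  -- The choice `c = √(log N.card)` makes the bound `√(log N.card) + 2 √(log N.card)`. When the
  -- logarithm vanishes, as above, `c` tends to zero instead.
  · have hr := sqrt_pos.2 hpos
    have := hle _ hr
    rw [div_sqrt] at this
    linarith

theorem localMeanWidth_sub_le (K R : Set (EuclideanSpace ℝ (Fin p))) {t : ℝ} (ht : 0 < t) :
    localMeanWidth t (K - R) ≤ 100 * ((⨆ x ∈ R, localMeanWidthBall t (K - {x})) +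
      ENNReal.ofReal t⁻¹ * meanWidth R) := by
  classical
  rw [localMeanWidth, if_pos ht]
  rcases R.eq_empty_or_nonempty with rfl | hR
  · simp [meanWidth_empty]
  set S := ⨆ x ∈ R, localMeanWidthBall t (K - {x}) with hS
  have htinv : ENNReal.ofReal t⁻¹ ≠ 0 := by simpa using ht
  by_cases hw : meanWidth R = ∞
  · simp [hw, ENNReal.mul_top htinv, ENNReal.mul_top]
  by_cases hStop : S = ∞
  · simp [hStop, ENNReal.mul_top]
  obtain ⟨N, hN, hNR, hnet, hcard⟩ := exists_net_of_meanWidth_ne_top hR hw ht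
  set W := (meanWidth R).toReal with hW
  set γ := stdGaussian (EuclideanSpace ℝ (Fin p)) with hγ
  refine meanWidth_le_of_forall_finset fun s hs hsA => ?_
  have hdec : ∀ f : EuclideanSpace ℝ (Fin p), ∃ q : EuclideanSpace ℝ (Fin p) ×
      EuclideanSpace ℝ (Fin p) × EuclideanSpace ℝ (Fin p), f ∈ s →
        q.1 ∈ K ∧ q.2.1 ∈ R ∧ q.2.2 ∈ N ∧ f = t⁻¹ • (q.1 - q.2.1) ∧ ‖f‖ = 1 ∧
          ‖q.2.1 - q.2.2‖ ≤ t := by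
    intro f
    by_cases hf : f ∈ s
    · obtain ⟨⟨_, ⟨v, hv, x, hx, rfl⟩, rfl⟩, hf2⟩ := hsA hf
      obtain ⟨y, hy, hxy⟩ := hnet x hx
      exact ⟨(v, x, y), fun _ => ⟨hv, hx, hy, rfl, by simpa using hf2, hxy⟩⟩
    · exact ⟨0, fun h => absurd h hf⟩
  choose q hq using hdec
  set u : EuclideanSpace ℝ (Fin p) → EuclideanSpace ℝ (Fin p) := fun f =>
    (2 * t)⁻¹ • ((q f).1 - (q f).2.2) with hu
  set x : EuclideanSpace ℝ (Fin p) → EuclideanSpace ℝ (Fin p) := fun f => (q f).2.1 with hx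
  set κ : EuclideanSpace ℝ (Fin p) → EuclideanSpace ℝ (Fin p) := fun f => (q f).2.2 with hκ
  have hball : ∀ f ∈ s, ‖u f‖ ≤ 1 := by
    intro f hf
    obtain ⟨_, _, _, hfe, hf1, hxy⟩ := hq f hf
    have h1 : ‖(q f).1 - (q f).2.1‖ = t := by
      have : (q f).1 - (q f).2.1 = t • f := by
        conv_rhs => rw [hfe]
        rw [smul_smul, mul_inv_cancel₀ ht.ne', one_smul]
      rw [this, norm_smul, hf1, mul_one, Real.norm_eq_abs, abs_of_pos ht]
    have h2 : ‖(q f).1 - (q f).2.2‖ ≤ 2 * t := by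
      have := norm_sub_le_norm_sub_add_norm_sub (q f).1 (q f).2.1 (q f).2.2
      linarith
    simp only [hu]
    rw [norm_smul, norm_inv, Real.norm_eq_abs, abs_of_pos (by positivity : 0 < 2 * t),
      inv_mul_le_iff₀ (by positivity)]
    linarith
  have hfiber : ∀ j (hj : (s.filter (κ · = j)).Nonempty),
      ∫ g, maxInner (s.filter (κ · = j)) hj u g ∂γ ≤ S.toReal := by
    intro j hj
    have hjR : j ∈ R := by
      obtain ⟨f, hf⟩ := hj
      obtain ⟨hfs, rfl⟩ := Finset.mem_filter.1 hf
      exact hNR (hq f hfs).2.2.1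
    rw [← ENNReal.ofReal_le_iff_le_toReal hStop]
    have hle : ENNReal.ofReal (∫ g, maxInner (s.filter (κ · = j)) hj u g ∂γ)
        ≤ localMeanWidthBall t (K - {j}) := by
      rw [localMeanWidthBall]
      refine ofReal_integral_maxInner_le_meanWidth hj fun f hf => ?_
      obtain ⟨hfs, hfj⟩ := Finset.mem_filter.1 hf
      refine ⟨?_, by simpa using hball f hfs⟩
      have huf : u f = (2 * t)⁻¹ • ((q f).1 - j) := by rw [← hfj]
      rw [huf]
      exact Set.smul_mem_smul_set (Set.sub_mem_sub (hq f hfs).1 (Set.mem_singleton j))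
    exact hle.trans (le_iSup₂_of_le j hjR le_rfl)
  have h1 : ∫ g, maxInner s hs u g ∂γ ≤ S.toReal + 3 * √(log N.card) :=
    integral_maxInner_le_add_sqrt_log hs hball (fun f hf => (hq f hf).2.2.1) hfiber
  have h2 : ∫ g, maxInner s hs κ g ∂γ ≤ W :=
    integral_maxInner_le_toReal_meanWidth hs (fun f hf => hNR (hq f hf).2.2.1) hw
  have h3 : ∫ g, maxInner s hs (fun f => -x f) g ∂γ ≤ W := by
    rw [integral_maxInner_neg hs x]
    exact integral_maxInner_le_toReal_meanWidth hs (fun f hf => (hq f hf).2.1) hw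
  have hI1 : Integrable (fun g => maxInner s hs κ g + maxInner s hs (fun f => -x f) g) γ :=
    (integrable_maxInner hs κ).add (integrable_maxInner hs _)
  have hI2 := (integrable_maxInner hs u).const_mul 2
  have h4 : ∫ g, maxInner s hs id g ∂γ ≤ ∫ g, (2 * maxInner s hs u g
      + t⁻¹ * (maxInner s hs κ g + maxInner s hs (fun f => -x f) g)) ∂γ := by
    refine integral_mono (integrable_maxInner hs id) (hI2.add (hI1.const_mul _)) fun g => ?_
    refine (maxInner_le_iff hs id g).2 fun f hf => ?_
    -- Passing through the net point `κ f` near `x f`: the ball part `u f` ranges over only `N.card`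
    -- families, and the correction is charged to `R` and `-R`.
    have e1 : f = (2 : ℝ) • u f + t⁻¹ • (κ f + -x f) := by
      conv_lhs => rw [(hq f hf).2.2.2.1]
      simp only [hu, hκ, hx]
      rw [smul_smul, mul_inv, ← mul_assoc, mul_inv_cancel₀ two_ne_zero, one_mul, ← smul_add]
      congr 1; abel
    have e2 : ⟪g, f⟫ = 2 * ⟪g, u f⟫ + t⁻¹ * (⟪g, κ f⟫ + ⟪g, -x f⟫) := by
      conv_lhs => rw [e1]
      rw [inner_add_right, real_inner_smul_right g (u f), real_inner_smul_right g (κ f + -x f),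
        inner_add_right g (κ f)]
    have htp : 0 < t⁻¹ := inv_pos.2 ht
    simp only [id]
    rw [e2]
    have i1 := inner_le_maxInner hs u g hf
    have i2 := inner_le_maxInner hs κ g hf
    have i3 := inner_le_maxInner hs (fun f => -x f) g hf
    gcongr
  rw [integral_add hI2 (hI1.const_mul _), integral_const_mul, integral_const_mul,
    integral_add (integrable_maxInner hs κ) (integrable_maxInner hs _)] at h4
  have hW0 : 0 ≤ W := ENNReal.toReal_nonneg
  have hS0 : 0 ≤ S.toReal := ENNReal.toReal_nonneg
  have h5 : √(log N.card) ≤ 14 * (t⁻¹ * W) := by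
    have : √(log N.card) ≤ 14 * W / t := by rw [le_div_iff₀ ht, mul_comm]; exact hcard
    calc _ ≤ _ := this
      _ = _ := by ring
  -- The terms add up to `2 S + (2 * 3 * 14 + 2) t⁻¹ W`.
  have hfinal : ∫ g, maxInner s hs id g ∂γ ≤ 100 * (S.toReal + t⁻¹ * W) := by
    have h6 : t⁻¹ * (∫ g, maxInner s hs κ g ∂γ + ∫ g, maxInner s hs (fun f => -x f) g ∂γ)
        ≤ t⁻¹ * (W + W) := by gcongr
    have h7 : 0 ≤ t⁻¹ * W := by positivity
    linarith
  refine (ENNReal.ofReal_le_ofReal hfinal).trans (le_of_eq ?_)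
  rw [ENNReal.ofReal_mul (by norm_num), ENNReal.ofReal_add hS0 (by positivity),
    ENNReal.ofReal_mul (by positivity), ENNReal.ofReal_toReal hStop, ENNReal.ofReal_toReal hw]
  norm_num

theorem integral_abs_inner_le_one {e : EuclideanSpace ℝ (Fin p)} (he : ‖e‖ = 1) :
    ∫ g, |⟪g, e⟫| ∂(stdGaussian (EuclideanSpace ℝ (Fin p))) ≤ 1 := by
  set γ := stdGaussian (EuclideanSpace ℝ (Fin p))
  have h := integral_inner_mul_inner_stdGaussian e e
  rw [real_inner_self_eq_norm_sq, he] at h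
  -- A non-integrable function would have integral zero by convention, but the integral is one.
  have hi : Integrable (fun g => ⟪e, g⟫ * ⟪e, g⟫) γ := by
    by_contra hni
    rw [integral_undef hni] at h
    norm_num at h
  have h2 : ∫ g, |⟪g, e⟫| ∂γ ≤ ∫ g, (1 / 2 * (⟪e, g⟫ * ⟪e, g⟫) + 1 / 2) ∂γ := by
    refine integral_mono (integrable_inner_stdGaussian e).abs
      ((hi.const_mul _).add (integrable_const _)) fun g => ?_
    simp only
    rw [real_inner_comm, ← abs_mul_abs_self ⟪e, g⟫]
    nlinarith [sq_nonneg (|⟪e, g⟫| - 1)]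
  rw [integral_add (hi.const_mul _) (integrable_const _), integral_const_mul, h] at h2
  simp only [integral_const, probReal_univ, one_smul] at h2
  linarith

theorem localMeanWidthBall_sub_singleton_le (K : Set (EuclideanSpace ℝ (Fin p)))
    {x x' : EuclideanSpace ℝ (Fin p)} {t : ℝ} (ht : 0 < t) (hxx' : ‖x - x'‖ ≤ t) :
    localMeanWidthBall t (K - {x}) ≤ 100 * (localMeanWidth 0 (K - {x'}) + 1) := by
  classical
  set C := linearCone (K - {x'}) ∩ Metric.sphere (0 : EuclideanSpace ℝ (Fin p)) 1 with hC
  have h0 : localMeanWidth 0 (K - {x'}) = meanWidth C := by simp [localMeanWidth, hC]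
  rw [h0, localMeanWidthBall]
  by_cases hw : meanWidth C = ∞
  · simp [hw, ENNReal.mul_top]
  set γ := stdGaussian (EuclideanSpace ℝ (Fin p)) with hγ
  refine meanWidth_le_of_forall_finset fun s hs hsA => ?_
  have hunit : ∀ v ∈ K, v ≠ x' → ‖v - x'‖⁻¹ • (v - x') ∈ C := by
    intro v hv hne
    have hpos : 0 < ‖v - x'‖ := norm_pos_iff.2 (sub_ne_zero.2 hne)
    refine ⟨⟨v - x', ⟨v, hv, x', rfl, rfl⟩, _, (inv_pos.2 hpos).le, rfl⟩, ?_⟩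
    simp [norm_smul, hpos.ne']
  set d := (2 * t)⁻¹ • (x' - x) with hd
  -- If no unit direction exists then `K ⊆ {x'}`, so every point of `s` equals `d` and the mean is
  -- zero. Otherwise `e₀` serves as the direction when `v = x'`.
  rcases C.eq_empty_or_nonempty with hCe | ⟨e₀, he₀⟩
  · have hK : ∀ v ∈ K, v = x' := fun v hv => by
      by_contra hne
      have := hunit v hv hne
      rw [hCe] at this
      exact this
    have h1 : ∫ g, maxInner s hs id g ∂γ ≤ ∫ g, ⟪g, d⟫ ∂γ := by
      refine integral_mono (integrable_maxInner hs id) (integrable_inner_stdGaussian d) fun g => ?_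
      refine (maxInner_le_iff hs id g).2 fun f hf => ?_
      obtain ⟨⟨_, ⟨v, hv, y, hy, rfl⟩, rfl⟩, -⟩ := hsA hf
      rw [Set.mem_singleton_iff] at hy
      rw [hK v hv, hy]
      rfl
    rw [integral_inner_stdGaussian] at h1
    rw [ENNReal.ofReal_of_nonpos h1]
    exact zero_le
  have he₀1 : ‖e₀‖ = 1 := by simpa using he₀.2
  -- The factor `3 / 2` is `3t / (2t)`, from `‖v - x'‖ ≤ ‖v - x‖ + ‖x - x'‖ ≤ 3t`.
  have hdec : ∀ f : EuclideanSpace ℝ (Fin p), ∃ q : ℝ × EuclideanSpace ℝ (Fin p),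
      q.2 ∈ C ∧ (f ∈ s → 0 ≤ q.1 ∧ q.1 ≤ 3 / 2 ∧ f = q.1 • q.2 + d) := by
    intro f
    by_cases hf : f ∈ s
    · obtain ⟨⟨_, ⟨v, hv, y, hy, rfl⟩, rfl⟩, hball⟩ := hsA hf
      rw [Set.mem_singleton_iff] at hy
      subst hy
      by_cases hvx : v = x'
      · exact ⟨(0, e₀), he₀, fun _ => ⟨le_rfl, by norm_num, by simp [hvx, hd]⟩⟩
      · have hpos : 0 < ‖v - x'‖ := norm_pos_iff.2 (sub_ne_zero.2 hvx)
        refine ⟨((2 * t)⁻¹ * ‖v - x'‖, _), hunit v hv hvx, fun _ => ⟨by positivity, ?_, ?_⟩⟩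
        · have h1 : ‖v - y‖ ≤ 2 * t := by
            have h2 : ‖(2 * t)⁻¹ • (v - y)‖ ≤ 1 := by simpa using hball
            rw [norm_smul, norm_inv, Real.norm_eq_abs, abs_of_pos (by positivity : 0 < 2 * t),
              inv_mul_le_iff₀ (by positivity)] at h2
            linarith
          have h3 := norm_sub_le_norm_sub_add_norm_sub v y x'
          simp only
          rw [inv_mul_le_iff₀ (by positivity)]
          linarith
        · simp only [hd]
          rw [smul_smul, mul_assoc, mul_inv_cancel₀ hpos.ne', mul_one, ← smul_add]
          simp
    · exact ⟨(0, e₀), he₀, fun h => absurd h hf⟩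
  choose q hq using hdec
  -- The maximum over the directions may be negative, and then scaling by a factor below `3 / 2` is
  -- not monotone. Adjoining `e₀` makes the maximum plus `|⟪g, e₀⟫|` nonnegative, at the cost of a
  -- mean at most one.
  set e : Option (EuclideanSpace ℝ (Fin p)) → EuclideanSpace ℝ (Fin p) := fun o =>
    o.elim e₀ fun f => (q f).2 with he
  set s' : Finset (Option (EuclideanSpace ℝ (Fin p))) := Finset.insertNone s with hs'
  have hs'ne : s'.Nonempty := ⟨none, by simp [hs']⟩
  have h1 : ∫ g, maxInner s' hs'ne e g ∂γ ≤ (meanWidth C).toReal := by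
    refine integral_maxInner_le_toReal_meanWidth hs'ne (fun o _ => ?_) hw
    cases o with
    | none => exact he₀
    | some f => exact (hq f).1
  have hI : Integrable (fun g => 3 / 2 * (maxInner s' hs'ne e g + |⟪g, e₀⟫|)) γ :=
    ((integrable_maxInner hs'ne e).add (integrable_inner_stdGaussian e₀).abs).const_mul _
  have h2 : ∫ g, maxInner s hs id g ∂γ
      ≤ ∫ g, (3 / 2 * (maxInner s' hs'ne e g + |⟪g, e₀⟫|) + ⟪g, d⟫) ∂γ := by
    refine integral_mono (integrable_maxInner hs id)
      (hI.add (integrable_inner_stdGaussian d)) fun g => ?_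
    refine (maxInner_le_iff hs id g).2 fun f hf => ?_
    obtain ⟨hr0, hr1, hfe⟩ := (hq f).2 hf
    have i1 : ⟪g, (q f).2⟫ ≤ maxInner s' hs'ne e g :=
      inner_le_maxInner hs'ne e g (i := some f) (by simpa [hs'] using hf)
    have i2 : ⟪g, e₀⟫ ≤ maxInner s' hs'ne e g :=
      inner_le_maxInner hs'ne e g (i := none) (by simp [hs'])
    have i3 : 0 ≤ maxInner s' hs'ne e g + |⟪g, e₀⟫| := by linarith [neg_abs_le ⟪g, e₀⟫]
    have i4 : (q f).1 * ⟪g, (q f).2⟫ ≤ 3 / 2 * (maxInner s' hs'ne e g + |⟪g, e₀⟫|) :=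
      (mul_le_mul_of_nonneg_left (by linarith [abs_nonneg ⟪g, e₀⟫]) hr0).trans
        (mul_le_mul_of_nonneg_right hr1 i3)
    have i5 : ⟪g, f⟫ = (q f).1 * ⟪g, (q f).2⟫ + ⟪g, d⟫ := by
      conv_lhs => rw [hfe]
      rw [inner_add_right, real_inner_smul_right]
    simp only [id]
    linarith
  rw [integral_add hI (integrable_inner_stdGaussian d), integral_inner_stdGaussian,
    integral_const_mul, integral_add (integrable_maxInner hs'ne e)
      (integrable_inner_stdGaussian e₀).abs] at h2
  have h3 := integral_abs_inner_le_one he₀1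
  have hW0 : 0 ≤ (meanWidth C).toReal := ENNReal.toReal_nonneg
  have h4 : ∫ g, maxInner s hs id g ∂γ ≤ 100 * ((meanWidth C).toReal + 1) := by linarith
  refine (ENNReal.ofReal_le_ofReal h4).trans (le_of_eq ?_)
  rw [ENNReal.ofReal_mul (by norm_num), ENNReal.ofReal_add hW0 zero_le_one,
    ENNReal.ofReal_toReal hw]
  norm_num

end LocalMeanWidth

theorem proposition3p2 :
    ∃ C : ℝ≥0, 0 < C ∧
      ∀ (p : ℕ) (K R : Set (EuclideanSpace ℝ (Fin p))) (t : ℝ), 0 < t →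
        localMeanWidth t (K - R) ≤
            (C : ℝ≥0∞) * ((⨆ x ∈ R, localMeanWidthBall t (K - {x})) +
              ENNReal.ofReal t⁻¹ * meanWidth R) ∧
        (Convex ℝ K → ∀ x ∈ R, ∀ x' ∈ K, ‖x - x'‖ ≤ t →
          localMeanWidthBall t (K - {x}) ≤
            (C : ℝ≥0∞) * (localMeanWidth 0 (K - {x'}) + 1)) := by
  refine ⟨100, by norm_num, fun p K R t ht => ⟨?_, fun _ x _ x' _ hxx' => ?_⟩⟩
  · exact_mod_cast localMeanWidth_sub_le K R ht
  · exact_mod_cast localMeanWidthBall_sub_singleton_le K ht hxx'
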